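/- Let $G$ be a finite group. Let $\mathcal P_G$ be the category whose objects are the finite $G$-sets and whose morphisms $X\to Y$ are the isomorphism classes of bispans $X\leftarrow A\to B\to Y$ of finite $G$-sets, with the usual composition of polynomials. A $G$-Tambara functor $T$ is a functor from $\mathcal P_G$ to sets that preserves finite products and is such that each $T(X)$, with its induced commutative semiring structure, is a ring. For subgroups $H\le K\le G$ and $g\in G$ it has restrictions $\mathrm{res}^K_H\colon T(G/K)\to T(G/H)$, transfers and norms $\mathrm{tr}^K_H,\mathrm{nm}^K_H\colon T(G/H)\to T(G/K)$, and conjugations $\mathrm{conj}_{g,H}\colon T(G/H)\to T(G/gHg^{-1})$. A (Tambara) ideal $I$ of $T$ is a family of ideals $I(G/H)\subseteq T(G/H)$, $H\le G$, closed under all restrictions, transfers, norms and conjugations; ideals are ordered by levelwise inclusion. The product $IJ$ is the smallest ideal of $T$ with $I(G/H)\,J(G/H)\subseteq (IJ)(G/H)$ for all $H\le G$. An ideal $\mathfrak p$ is prime if $\mathfrak p\neq T$ and, for all ideals $I,J$ of $T$, $IJ\subseteq\mathfrak p$ implies $I\subseteq\mathfrak p$ or $J\subseteq\mathfrak p$.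 Proposition. Let $T$ be a $G$-Tambara functor, let $H\le G$, and let $S\subseteq T(G/H)$ be a subset that is multiplicatively closed (that is, $ab\in S$ for all $a,b\in S$; $S$ may be empty and need not contain $1$) and does not contain $0$. Then there is an ideal $\mathfrak p$ of $T$ that is maximal among the ideals $I$ of $T$ with $I(G/H)\cap S=\varnothing$. Moreover, if $S$ is nonempty, then every such maximal $\mathfrak p$ is a prime ideal of $T$. -/

import Mathlib

universe u w

/-- A finite `G`-set. -/
structure FinGSet (G : Type u) [Group G] : Type (u + 1) where
  carrier : Type u
  [mulAction : MulAction G carrier]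
  [finite : Finite carrier]

namespace FinGSet

variable {G : Type u} [Group G]

instance : CoeSort (FinGSet G) (Type u) := ⟨FinGSet.carrier⟩

instance (X : FinGSet G) : MulAction G X := X.mulAction

instance (X : FinGSet G) : Finite X := X.finite

/-- The empty `G`-set. -/
def empty (G : Type u) [Group G] : FinGSet G :=
  letI : MulAction G PEmpty.{u + 1} :=
    { smul := fun _ x => x, one_smul := fun _ => rfl, mul_smul := fun _ _ _ => rfl }
  ⟨PEmpty.{u + 1}⟩

instance : IsEmpty (empty G) := inferInstanceAs (IsEmpty PEmpty)

/-- The disjoint union of two finite `G`-sets. -/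
def sum (X Y : FinGSet G) : FinGSet G := ⟨X ⊕ Y⟩

/-- The orbit `G/H`. -/
def orbit [Finite G] (H : Subgroup G) : FinGSet G := ⟨G ⧸ H⟩

/-- The map `∅ → X`. -/
def fromEmpty (X : FinGSet G) : empty G →[G] X where
  toFun := isEmptyElim
  map_smul' := fun _ x => isEmptyElim x

/-- The left inclusion `X → X ⨿ Y`. -/
def inl (X Y : FinGSet G) : X →[G] X.sum Y where
  toFun := Sum.inl
  map_smul' := fun _ _ => rfl

/-- The right inclusion `Y → X ⨿ Y`. -/
def inr (X Y : FinGSet G) : Y →[G] X.sum Y where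
  toFun := Sum.inr
  map_smul' := fun _ _ => rfl

/-- The map `X ⨿ Y → Z` induced by maps `X → Z` and `Y → Z`. -/
def desc {X Y Z : FinGSet G} (f : X →[G] Z) (g : Y →[G] Z) : X.sum Y →[G] Z where
  toFun := Sum.elim f g
  map_smul' := by rintro c (x | y) <;> [exact map_smul f c x; exact map_smul g c y]

/-- The fold map `∇ : X ⨿ X → X`. -/
def fold (X : FinGSet G) : X.sum X →[G] X := desc (.id G) (.id G)

end FinGSet

/-- A bispan `X ← A → B → Y` of finite `G`-sets. -/
structure Bispan {G : Type u} [Group G] (X Y : FinGSet G) : Type (u + 1) where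
  A : FinGSet G
  B : FinGSet G
  r : A →[G] X
  n : A →[G] B
  t : B →[G] Y

namespace Bispan

variable {G : Type u} [Group G] {X Y Z W : FinGSet G}

/-- Two bispans are isomorphic if there are equivariant bijections `A ≅ A'` and `B ≅ B'` making
the evident diagram commute. -/
def IsIso (P Q : Bispan X Y) : Prop :=
  ∃ (α : P.A →[G] Q.A) (β : P.B →[G] Q.B), Function.Bijective α ∧ Function.Bijective β ∧
    (∀ a, Q.r (α a) = P.r a) ∧ (∀ a, Q.n (α a) = β (P.n a)) ∧ ∀ b, Q.t (β b) = P.t b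

theorem IsIso.refl (P : Bispan X Y) : IsIso P P :=
  ⟨.id G, .id G, Function.bijective_id, Function.bijective_id, fun _ => rfl, fun _ => rfl,
    fun _ => rfl⟩

/-- The inverse of an equivariant bijection. -/
noncomputable def invHom {X Y : FinGSet G} (f : X →[G] Y) (hf : Function.Bijective f) :
    Y →[G] X where
  toFun := (Equiv.ofBijective f hf).symm
  map_smul' := by
    intro c y
    refine hf.1 (((Equiv.ofBijective f hf).apply_symm_apply _).trans ?_)
    exact ((map_smul f c _).trans
      (congrArg (c • ·) ((Equiv.ofBijective f hf).apply_symm_apply y))).symm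

theorem apply_invHom {X Y : FinGSet G} (f : X →[G] Y) (hf : Function.Bijective f) (y : Y) :
    f (invHom f hf y) = y := (Equiv.ofBijective f hf).apply_symm_apply y

theorem invHom_apply {X Y : FinGSet G} (f : X →[G] Y) (hf : Function.Bijective f) (x : X) :
    invHom f hf (f x) = x := (Equiv.ofBijective f hf).symm_apply_apply x

theorem invHom_bijective {X Y : FinGSet G} (f : X →[G] Y) (hf : Function.Bijective f) :
    Function.Bijective (invHom f hf) := (Equiv.ofBijective f hf).symm.bijective

theorem IsIso.symm {P Q : Bispan X Y} : IsIso P Q → IsIso Q P := by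
  rintro ⟨α, β, hα, hβ, h1, h2, h3⟩
  refine ⟨invHom α hα, invHom β hβ, invHom_bijective _ _, invHom_bijective _ _, ?_, ?_, ?_⟩
  · intro a
    rw [← h1, apply_invHom]
  · intro a
    apply hβ.1
    rw [← h2, apply_invHom, apply_invHom]
  · intro b
    rw [← h3, apply_invHom]

theorem IsIso.trans {P Q R : Bispan X Y} : IsIso P Q → IsIso Q R → IsIso P R := by
  rintro ⟨α, β, hα, hβ, h1, h2, h3⟩ ⟨α', β', hα', hβ', h1', h2', h3'⟩
  refine ⟨α'.comp α, β'.comp β, hα'.comp hα, hβ'.comp hβ, ?_, ?_, ?_⟩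
  · intro a
    exact (h1' _).trans (h1 a)
  · intro a
    exact (h2' _).trans (congrArg β' (h2 a))
  · intro a
    exact (h3' _).trans (h3 a)

/-- Isomorphism of bispans, as an equivalence relation. -/
def setoid (X Y : FinGSet G) : Setoid (Bispan X Y) :=
  ⟨IsIso, IsIso.refl, IsIso.symm, IsIso.trans⟩

/-- `R` is (the graph of) a section `s` of `P.t` over the fibre of `Q.n` above `d`, that is, a
function assigning to every `c` in this fibre an element `s c` with `P.t (s c) = Q.r c`. -/
def IsSection (P : Bispan X Y) (Q : Bispan Y Z) (d : Q.B) (R : Q.A → P.B → Prop) : Prop :=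
  (∀ c b, R c b → Q.n c = d ∧ P.t b = Q.r c) ∧ ∀ c, Q.n c = d → ∃! b, R c b

/-- The pairs `(d, s)` of a point `d` of `Q.B` and a section `s` as in `IsSection`. -/
@[ext]
structure CompB (P : Bispan X Y) (Q : Bispan Y Z) : Type u where
  d : Q.B
  R : Q.A → P.B → Prop
  isSection : IsSection P Q d R

theorem IsSection.smul {P : Bispan X Y} {Q : Bispan Y Z} {d : Q.B} {R : Q.A → P.B → Prop}
    (h : IsSection P Q d R) (g : G) :
    IsSection P Q (g • d) (fun c b => R (g⁻¹ • c) (g⁻¹ • b)) := by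
  refine ⟨fun c b hcb => ?_, fun c hc => ?_⟩
  · have := h.1 _ _ hcb
    rw [map_smul, map_smul, map_smul, inv_smul_eq_iff, smul_left_cancel_iff] at this
    exact this
  · obtain ⟨b, hb, hb'⟩ := h.2 (g⁻¹ • c) (by rw [map_smul, hc, inv_smul_smul])
    refine ⟨g • b, by simpa using hb, fun b' h' => ?_⟩
    rw [← hb' _ h', smul_inv_smul]

/-- `G` acts by `g • (d, s) = (g • d, c ↦ g • s (g⁻¹ • c))`. -/
instance (P : Bispan X Y) (Q : Bispan Y Z) : MulAction G (CompB P Q) where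
  smul g x := ⟨g • x.d, fun c b => x.R (g⁻¹ • c) (g⁻¹ • b), x.isSection.smul g⟩
  one_smul x := CompB.ext (one_smul G x.d) (by
    funext c b
    change x.R ((1 : G)⁻¹ • c) ((1 : G)⁻¹ • b) = _
    rw [inv_one, one_smul, one_smul])
  mul_smul g h x := CompB.ext (mul_smul g h x.d) (by
    funext c b
    change x.R ((g * h)⁻¹ • c) ((g * h)⁻¹ • b) = x.R (h⁻¹ • g⁻¹ • c) (h⁻¹ • g⁻¹ • b)
    rw [mul_inv_rev, mul_smul, mul_smul])

instance (P : Bispan X Y) (Q : Bispan Y Z) : Finite (CompB P Q) :=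
  Finite.of_injective (fun x => (x.d, x.R)) fun _ _ h =>
    CompB.ext (congrArg Prod.fst h) (congrArg Prod.snd h)

/-- The triples `((d, s), c, a)` with `c` in the fibre above `d` and `a` in the fibre of `P.n`
above `s c`. -/
@[ext]
structure CompA (P : Bispan X Y) (Q : Bispan Y Z) : Type u where
  b : CompB P Q
  c : Q.A
  a : P.A
  mem : b.R c (P.n a)

instance (P : Bispan X Y) (Q : Bispan Y Z) : MulAction G (CompA P Q) where
  smul g x := ⟨g • x.b, g • x.c, g • x.a, by
    change x.b.R (g⁻¹ • g • x.c) (g⁻¹ • P.n (g • x.a))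
    rw [map_smul, inv_smul_smul, inv_smul_smul]
    exact x.mem⟩
  one_smul x := CompA.ext (one_smul G x.b) (one_smul G x.c) (one_smul G x.a)
  mul_smul g h x := CompA.ext (mul_smul g h x.b) (mul_smul g h x.c) (mul_smul g h x.a)

instance (P : Bispan X Y) (Q : Bispan Y Z) : Finite (CompA P Q) :=
  Finite.of_injective (fun x => (x.b, x.c, x.a)) fun _ _ h =>
    CompA.ext (congrArg Prod.fst h) (congrArg (fun z => z.2.1) h) (congrArg (fun z => z.2.2) h)

/-- The composite of the bispans `P = (X ← A → B → Y)` and `Q = (Y ← C → D → Z)`: its third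
term is the dependent product along `C → D` of the pullback of `B → Y` to `C`. -/
def comp (P : Bispan X Y) (Q : Bispan Y Z) : Bispan X Z where
  A := ⟨CompA P Q⟩
  B := ⟨CompB P Q⟩
  r :=
    { toFun := fun x => P.r x.a
      map_smul' := fun g x => map_smul P.r g x.a }
  n :=
    { toFun := fun x => x.b
      map_smul' := fun _ _ => rfl }
  t :=
    { toFun := fun x => Q.t x.d
      map_smul' := fun g x => map_smul Q.t g x.d }

/-- The data exhibiting a bispan `V` as a composite of `P` and `Q`. -/
structure CompData (P : Bispan X Y) (Q : Bispan Y Z) (V : Bispan X Z) where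
  u : V.B → Q.B
  E : V.B → Q.A → P.B → Prop
  k : V.A → Q.A
  l : V.A → P.A
  u_smul : ∀ (g : G) w, u (g • w) = g • u w
  E_smul : ∀ (g : G) w c b, E w c b → E (g • w) (g • c) (g • b)
  k_smul : ∀ (g : G) a, k (g • a) = g • k a
  l_smul : ∀ (g : G) a, l (g • a) = g • l a
  t_eq : ∀ w, V.t w = Q.t (u w)
  r_eq : ∀ a, V.r a = P.r (l a)
  isSection : ∀ w, IsSection P Q (u w) (E w)
  univ : ∀ d R, IsSection P Q d R → ∃! w, u w = d ∧ ∀ c b, E w c b ↔ R c b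
  mem : ∀ a, E (V.n a) (k a) (P.n (l a))
  univA : ∀ w c a', E w c (P.n a') → ∃! a, V.n a = w ∧ k a = c ∧ l a = a'

/-- The explicit composite is a composite. -/
def compData (P : Bispan X Y) (Q : Bispan Y Z) : CompData P Q (comp P Q) where
  u := CompB.d
  E := CompB.R
  k := CompA.c
  l := CompA.a
  u_smul _ _ := rfl
  E_smul g w c b h := by
    change w.R (g⁻¹ • g • c) (g⁻¹ • g • b)
    rwa [inv_smul_smul, inv_smul_smul]
  k_smul _ _ := rfl
  l_smul _ _ := rfl
  t_eq _ := rfl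
  r_eq _ := rfl
  isSection w := w.isSection
  univ d R h := ⟨⟨d, R, h⟩, ⟨rfl, fun _ _ => Iff.rfl⟩, fun w hw =>
    CompB.ext hw.1 (funext fun c => funext fun b => propext (hw.2 c b))⟩
  mem a := a.mem
  univA w c a' h := ⟨⟨w, c, a', h⟩, ⟨rfl, rfl, rfl⟩, fun a ha => CompA.ext ha.1 ha.2.1 ha.2.2⟩

namespace CompData

variable {P : Bispan X Y} {Q : Bispan Y Z} {V V' : Bispan X Z}

theorem E_iff (h : CompData P Q V) (g : G) (w : V.B) (c : Q.A) (b : P.B) :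
    h.E (g • w) (g • c) (g • b) ↔ h.E w c b :=
  ⟨fun H => by simpa using h.E_smul g⁻¹ _ _ _ H, h.E_smul g w c b⟩

theorem ext_B (h : CompData P Q V) {w w' : V.B} (h1 : h.u w = h.u w')
    (h2 : ∀ c b, h.E w c b ↔ h.E w' c b) : w = w' :=
  (h.univ _ _ (h.isSection w')).unique ⟨h1, h2⟩ ⟨rfl, fun _ _ => Iff.rfl⟩

theorem ext_A (h : CompData P Q V) {a a' : V.A} (h1 : V.n a = V.n a')
    (h2 : h.k a = h.k a') (h3 : h.l a = h.l a') : a = a' :=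
  (h.univA _ _ _ (h.mem a')).unique ⟨h1, h2, h3⟩ ⟨rfl, rfl, rfl⟩

theorem E_smul_iff (h : CompData P Q V) (g : G) (w : V.B) (c : Q.A) (b : P.B) :
    h.E (g • w) c b ↔ h.E w (g⁻¹ • c) (g⁻¹ • b) := by
  rw [← h.E_iff g w, smul_inv_smul, smul_inv_smul]

theorem u_mem (h : CompData P Q V) (a : V.A) : Q.n (h.k a) = h.u (V.n a) :=
  ((h.isSection _).1 _ _ (h.mem a)).1

theorem t_mem (h : CompData P Q V) (a : V.A) : P.t (P.n (h.l a)) = Q.r (h.k a) :=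
  ((h.isSection _).1 _ _ (h.mem a)).2

/-- Any two composites are isomorphic. -/
theorem isIso (h : CompData P Q V) (h' : CompData P Q V') : IsIso V V' := by
  choose β hβ using fun w => (h'.univ _ _ (h.isSection w)).exists
  have mem' : ∀ a, h'.E (β (V.n a)) (h.k a) (P.n (h.l a)) := fun a =>
    ((hβ (V.n a)).2 _ _).2 (h.mem a)
  choose α hα using fun a => (h'.univA _ _ _ (mem' a)).exists
  have β_smul : ∀ (g : G) w, β (g • w) = g • β w := fun g w => by
    apply h'.ext_B
    · rw [(hβ _).1, h'.u_smul, h.u_smul, (hβ _).1]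
    · intro c b
      rw [(hβ _).2, h'.E_smul_iff, h.E_smul_iff, (hβ _).2]
  have α_smul : ∀ (g : G) a, α (g • a) = g • α a := fun g a => by
    apply h'.ext_A
    · rw [(hα _).1, map_smul, map_smul, (hα _).1, β_smul]
    · rw [(hα _).2.1, h'.k_smul, h.k_smul, (hα _).2.1]
    · rw [(hα _).2.2, h'.l_smul, h.l_smul, (hα _).2.2]
  have hβb : Function.Bijective β := by
    refine ⟨fun w w' hw => ?_, fun w' => ?_⟩
    · apply h.ext_B
      · rw [← (hβ w).1, ← (hβ w').1, hw]
      · intro c b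
        rw [← (hβ w).2, ← (hβ w').2, hw]
    · obtain ⟨w, hw⟩ := (h.univ _ _ (h'.isSection w')).exists
      refine ⟨w, h'.ext_B ?_ ?_⟩
      · rw [(hβ w).1, hw.1]
      · intro c b
        rw [(hβ w).2, hw.2]
  refine ⟨⟨α, α_smul⟩, ⟨β, β_smul⟩, ⟨fun a a' haa => ?_, fun a' => ?_⟩, hβb, ?_, ?_, ?_⟩
  · change α a = α a' at haa
    apply h.ext_A
    · apply hβb.1
      rw [← (hα a).1, ← (hα a').1, haa]
    · rw [← (hα a).2.1, ← (hα a').2.1, haa]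
    · rw [← (hα a).2.2, ← (hα a').2.2, haa]
  · obtain ⟨w, hw⟩ := hβb.2 (V'.n a')
    have := h'.mem a'
    rw [← hw, (hβ w).2] at this
    obtain ⟨a, ha⟩ := (h.univA _ _ _ this).exists
    refine ⟨a, h'.ext_A ?_ ?_ ?_⟩
    · exact (hα a).1.trans (by rw [ha.1, hw])
    · exact (hα a).2.1.trans ha.2.1
    · exact (hα a).2.2.trans ha.2.2
  · intro a
    change V'.r (α a) = _
    rw [h'.r_eq, h.r_eq, (hα a).2.2]
  · intro a
    exact (hα a).1
  · intro w
    change V'.t (β w) = _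
    rw [h'.t_eq, h.t_eq, (hβ w).1]

/-- Composites of isomorphic bispans. -/
noncomputable def ofIso {P' : Bispan X Y} {Q' : Bispan Y Z} (h : CompData P' Q' V)
    (hP : IsIso P P') (hQ : IsIso Q Q') : CompData P Q V := by
  choose α β hα hβ h1 h2 h3 using hP
  choose α' β' hα' hβ' h1' h2' h3' using hQ
  have key : ∀ d R, IsSection P Q d R ↔ IsSection P' Q' (β' d)
      (fun c b => R (invHom α' hα' c) (invHom β hβ b)) := by
    intro d R
    have e1 : ∀ c, Q'.n c = β' d ↔ Q.n (invHom α' hα' c) = d := fun c => by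
      obtain ⟨c, rfl⟩ := hα'.2 c
      rw [h2', hβ'.1.eq_iff, invHom_apply]
    have e2 : ∀ c b, P'.t b = Q'.r c ↔ P.t (invHom β hβ b) = Q.r (invHom α' hα' c) := fun c b => by
      obtain ⟨c, rfl⟩ := hα'.2 c
      obtain ⟨b, rfl⟩ := hβ.2 b
      rw [h1', h3, invHom_apply, invHom_apply]
    unfold IsSection
    simp only [e1, e2]
    refine and_congr ?_ ?_
    · rw [← (Equiv.ofBijective _ hα').symm.forall_congr_right]
      refine forall_congr' fun c => ?_
      rw [← (Equiv.ofBijective _ hβ).symm.forall_congr_right]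
      rfl
    · rw [← (Equiv.ofBijective _ hα').symm.forall_congr_right]
      refine forall_congr' fun c => imp_congr Iff.rfl ?_
      rw [← (Equiv.ofBijective _ hβ).symm.existsUnique_congr_right]
      rfl
  exact
  { u := fun w => invHom β' hβ' (h.u w)
    E := fun w c b => h.E w (α' c) (β b)
    k := fun a => invHom α' hα' (h.k a)
    l := fun a => invHom α hα (h.l a)
    u_smul := fun g w => by rw [h.u_smul, map_smul]
    E_smul := fun g w c b H => by
      rw [map_smul, map_smul]
      exact h.E_smul _ _ _ _ H
    k_smul := fun g w => by rw [h.k_smul, map_smul]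
    l_smul := fun g w => by rw [h.l_smul, map_smul]
    t_eq := fun w => by rw [h.t_eq, ← h3', apply_invHom]
    r_eq := fun w => by rw [h.r_eq, ← h1, apply_invHom]
    isSection := fun w => by
      rw [key]
      simp only [apply_invHom]
      exact h.isSection w
    univ := fun d R H => by
      obtain ⟨w, hw, hw'⟩ := h.univ _ _ ((key d R).1 H)
      refine ⟨w, ⟨?_, fun c b => ?_⟩, fun w' H' => hw' w' ⟨?_, fun c b => ?_⟩⟩
      · rw [hw.1, invHom_apply]
      · rw [hw.2, invHom_apply, invHom_apply]
      · rw [← H'.1, apply_invHom]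
      · rw [← H'.2, apply_invHom, apply_invHom]
    mem := fun a => by
      rw [apply_invHom, ← h2, apply_invHom]
      exact h.mem a
    univA := fun w c a' H => by
      rw [← h2] at H
      obtain ⟨a, ha, ha'⟩ := h.univA _ _ _ H
      refine ⟨a, ⟨ha.1, ?_, ?_⟩, fun a₂ H' => ha' _ ⟨H'.1, ?_, ?_⟩⟩
      · rw [ha.2.1, invHom_apply]
      · rw [ha.2.2, invHom_apply]
      · rw [← H'.2.1, apply_invHom]
      · rw [← H'.2.2, apply_invHom] }

end CompData

theorem comp_isIso {P P' : Bispan X Y} {Q Q' : Bispan Y Z} (hP : IsIso P P') (hQ : IsIso Q Q') :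
    IsIso (comp P Q) (comp P' Q') :=
  (compData P Q).isIso ((compData P' Q').ofIso hP hQ)

/-- The identity bispan. -/
def id (X : FinGSet G) : Bispan X X := ⟨X, X, .id G, .id G, .id G⟩

/-- Composition with an identity bispan on the left. -/
def idCompData (P : Bispan X Y) : CompData (id X) P P where
  u := fun b => b
  E := fun b a x => P.n a = b ∧ P.r a = x
  k := fun a => a
  l := P.r
  u_smul _ _ := rfl
  E_smul g w c b h := ⟨by rw [map_smul, h.1], by rw [map_smul, h.2]; rfl⟩
  k_smul _ _ := rfl
  l_smul g a := map_smul P.r g a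
  t_eq _ := rfl
  r_eq _ := rfl
  isSection w := ⟨fun c b h => ⟨h.1, h.2.symm⟩,
    fun c hc => ⟨P.r c, ⟨hc, rfl⟩, fun b hb => hb.2.symm⟩⟩
  univ d R h := by
    refine ⟨d, ⟨rfl, fun c b => ⟨fun H => ?_, fun H => ?_⟩⟩, fun w hw => hw.1⟩
    · obtain ⟨b', hb', -⟩ := h.2 c H.1
      have : b' = b := (h.1 _ _ hb').2.trans H.2
      exact this ▸ hb'
    · exact ⟨(h.1 _ _ H).1, (h.1 _ _ H).2.symm⟩
  mem a := ⟨rfl, rfl⟩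
  univA w c a' h := ⟨c, ⟨h.1, rfl, h.2⟩, fun a ha => ha.2.1⟩

/-- Composition with an identity bispan on the right. -/
def compIdData (P : Bispan X Y) : CompData P (id Y) P where
  u := P.t
  E := fun b y b' => P.t b = y ∧ b = b'
  k := fun a => P.t (P.n a)
  l := fun a => a
  u_smul g w := map_smul P.t g w
  E_smul g w c b h := ⟨by rw [map_smul, h.1]; rfl, by rw [h.2]⟩
  k_smul g a := by rw [map_smul, map_smul]; rfl
  l_smul _ _ := rfl
  t_eq _ := rfl
  r_eq _ := rfl
  isSection w := ⟨fun c b h => ⟨h.1.symm, h.2 ▸ h.1⟩,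
    fun c hc => ⟨w, ⟨hc.symm, rfl⟩, fun b hb => hb.2.symm⟩⟩
  univ d R h := by
    obtain ⟨b, hb, hb'⟩ := h.2 d rfl
    have ht : P.t b = d := (h.1 _ _ hb).2
    refine ⟨b, ⟨ht, fun c b' => ⟨fun H => ?_, fun H => ?_⟩⟩, fun w hw => ?_⟩
    · obtain ⟨rfl, rfl⟩ := H
      rwa [ht]
    · have hc : c = d := (h.1 _ _ H).1
      subst hc
      exact ⟨ht, (hb' _ H).symm⟩
    · exact hb' _ ((hw.2 d w).1 ⟨hw.1, rfl⟩)
  mem a := ⟨rfl, rfl⟩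
  univA w c a' h := ⟨a', ⟨h.2.symm, h.2 ▸ h.1, rfl⟩, fun a ha => ha.2.2⟩

/-- Associativity of composition. -/
noncomputable def assocData {P : Bispan X Y} {Q : Bispan Y Z} {R : Bispan Z W}
    {V₁ : Bispan X Z} {V₂ : Bispan Y W} {V : Bispan X W} (h₁ : CompData P Q V₁)
    (h₂ : CompData V₁ R V) (h₃ : CompData Q R V₂) : CompData P V₂ V := by
  have sec : ∀ w, IsSection Q R (h₂.u w) (fun e d => ∃ v, h₂.E w e v ∧ h₁.u v = d) := by
    intro w
    refine ⟨?_, fun e he => ?_⟩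
    · rintro e d ⟨v, hv, rfl⟩
      exact ⟨((h₂.isSection w).1 _ _ hv).1, by rw [← h₁.t_eq, ((h₂.isSection w).1 _ _ hv).2]⟩
    · obtain ⟨v, hv, hv'⟩ := (h₂.isSection w).2 e he
      refine ⟨h₁.u v, ⟨v, hv, rfl⟩, ?_⟩
      rintro d ⟨v', hv'', rfl⟩
      rw [hv' _ hv'']
  choose u hu using fun w => (h₃.univ _ _ (sec w)).exists
  have memA : ∀ a, h₃.E (u (V.n a)) (h₂.k a) (Q.n (h₁.k (h₂.l a))) := fun a =>
    ((hu (V.n a)).2 _ _).2 ⟨_, h₂.mem a, (h₁.u_mem _).symm⟩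
  choose k hk using fun a => (h₃.univA _ _ _ (memA a)).exists
  have aux : ∀ w a₂, V₂.n a₂ = u w → ∃ v, h₂.E w (h₃.k a₂) v ∧ h₁.u v = Q.n (h₃.l a₂) := by
    intro w a₂ h
    rw [← (hu w).2, ← h]
    exact h₃.mem a₂
  have u_smul : ∀ (g : G) w, u (g • w) = g • u w := fun g w => by
    apply h₃.ext_B
    · rw [(hu _).1, h₃.u_smul, h₂.u_smul, (hu _).1]
    · intro e d
      rw [(hu _).2, h₃.E_smul_iff, (hu _).2, ← (MulAction.toPerm g).exists_congr_right]
      refine exists_congr fun v => ?_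
      rw [MulAction.toPerm_apply, h₂.E_smul_iff, inv_smul_smul, h₁.u_smul, eq_inv_smul_iff]
  exact
  { u := u
    E := fun w a₂ b => V₂.n a₂ = u w ∧ ∃ v, h₂.E w (h₃.k a₂) v ∧ h₁.E v (h₃.l a₂) b
    k := k
    l := fun a => h₁.l (h₂.l a)
    u_smul := u_smul
    E_smul := by
      rintro g w a₂ b ⟨h, v, hv, hv'⟩
      refine ⟨by rw [map_smul, h, u_smul], g • v, ?_, ?_⟩
      · rw [h₃.k_smul]
        exact h₂.E_smul _ _ _ _ hv
      · rw [h₃.l_smul]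
        exact h₁.E_smul _ _ _ _ hv'
    k_smul := fun g a => by
      apply h₃.ext_A
      · rw [(hk _).1, map_smul, map_smul, (hk _).1, u_smul]
      · rw [(hk _).2.1, h₃.k_smul, h₂.k_smul, (hk _).2.1]
      · rw [(hk _).2.2, h₃.l_smul, h₂.l_smul, h₁.k_smul, (hk _).2.2]
    l_smul := fun g a => by rw [h₂.l_smul, h₁.l_smul]
    t_eq := fun w => by rw [h₂.t_eq, h₃.t_eq, (hu w).1]
    r_eq := fun a => by rw [h₂.r_eq, h₁.r_eq]
    isSection := fun w => by
      refine ⟨?_, fun a₂ ha₂ => ?_⟩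
      · rintro a₂ b ⟨h, v, hv, hv'⟩
        exact ⟨h, by rw [((h₁.isSection _).1 _ _ hv').2, h₃.r_eq]⟩
      · obtain ⟨v, hv, hv'⟩ := aux w a₂ ha₂
        obtain ⟨b, hb, hb'⟩ := (h₁.isSection v).2 _ hv'.symm
        refine ⟨b, ⟨ha₂, v, hv, hb⟩, ?_⟩
        rintro b' ⟨-, v', hv₂, hb₂⟩
        have : v' = v := ((h₂.isSection w).2 _ ((h₂.isSection w).1 _ _ hv).1).unique hv₂ hv
        subst this
        exact hb' _ hb₂
    univ := fun d S hS => by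
      -- the section over `c`, for fixed `e`
      have sec₁ : ∀ e d', h₃.E d e d' →
          IsSection P Q d' (fun c b => ∃ a₂, V₂.n a₂ = d ∧ h₃.k a₂ = e ∧ h₃.l a₂ = c ∧ S a₂ b) := by
        intro e d' hd'
        refine ⟨?_, fun c hc => ?_⟩
        · rintro c b ⟨a₂, h1, rfl, rfl, hb⟩
          refine ⟨?_, by rw [(hS.1 _ _ hb).2, h₃.r_eq]⟩
          have hm := h₃.mem a₂
          rw [h1] at hm
          exact ((h₃.isSection d).2 _ ((h₃.isSection d).1 _ _ hd').1).unique hm hd'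
        · rw [← hc] at hd'
          obtain ⟨a₂, ⟨h1, h2, h3⟩, hu'⟩ := h₃.univA _ _ _ hd'
          obtain ⟨b, hb, hb'⟩ := hS.2 a₂ h1
          refine ⟨b, ⟨a₂, h1, h2, h3, hb⟩, ?_⟩
          rintro b' ⟨a₃, h1', h2', h3', hb₃⟩
          have : a₃ = a₂ := hu' _ ⟨h1', h2', h3'⟩
          subst this
          exact hb' _ hb₃
      have sec₂ : IsSection V₁ R (h₃.u d) (fun e v => h₃.E d e (h₁.u v) ∧ ∀ c b, h₁.E v c b ↔
          ∃ a₂, V₂.n a₂ = d ∧ h₃.k a₂ = e ∧ h₃.l a₂ = c ∧ S a₂ b) := by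
        refine ⟨?_, fun e he => ?_⟩
        · rintro e v ⟨hv, -⟩
          exact ⟨((h₃.isSection d).1 _ _ hv).1, by
            rw [h₁.t_eq, ((h₃.isSection d).1 _ _ hv).2]⟩
        · obtain ⟨d', hd', hd''⟩ := (h₃.isSection d).2 e he
          obtain ⟨v, hv, hv'⟩ := h₁.univ _ _ (sec₁ e d' hd')
          refine ⟨v, ⟨by rw [hv.1]; exact hd', hv.2⟩, fun v' h' => hv' _ ⟨hd'' _ h'.1, h'.2⟩⟩
      obtain ⟨w, hw, hw'⟩ := h₂.univ _ _ sec₂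
      have huw : u w = d := by
        apply h₃.ext_B
        · rw [(hu w).1, hw.1]
        · intro e d'
          rw [(hu w).2]
          constructor
          · rintro ⟨v, hv, rfl⟩
            exact ((hw.2 _ _).1 hv).1
          · intro hd'
            obtain ⟨v, hv⟩ := (h₁.univ _ _ (sec₁ e d' hd')).exists
            exact ⟨v, (hw.2 _ _).2 ⟨by rw [hv.1]; exact hd', hv.2⟩, hv.1⟩
      refine ⟨w, ⟨huw, fun a₂ b => ?_⟩, fun w' h' => hw' _ ⟨?_, fun e v => ?_⟩⟩
      · constructor
        · rintro ⟨h1, v, hv, hv'⟩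
          obtain ⟨a₃, h1', h2', h3', hb₃⟩ := (((hw.2 _ _).1 hv).2 _ _).1 hv'
          have : a₃ = a₂ := h₃.ext_A (by rw [h1', h1, huw]) h2' h3'
          exact this ▸ hb₃
        · intro hb
          have h1 := (hS.1 _ _ hb).1
          obtain ⟨v, hv, hv'⟩ := aux w a₂ (h1.trans huw.symm)
          exact ⟨h1.trans huw.symm, v, hv,
            (((hw.2 _ _).1 hv).2 _ _).2 ⟨a₂, h1, rfl, rfl, hb⟩⟩
      · rw [← (hu w').1, h'.1]
      · have hd : ∀ e d', h₃.E d e d' ↔ ∃ v, h₂.E w' e v ∧ h₁.u v = d' := fun e d' => by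
          rw [← h'.1]
          exact (hu w').2 e d'
        have hE : ∀ e v, h₂.E w' e v → ∀ c b, h₁.E v c b ↔
            ∃ a₂, V₂.n a₂ = d ∧ h₃.k a₂ = e ∧ h₃.l a₂ = c ∧ S a₂ b := by
          intro e v hv c b
          constructor
          · intro hb
            have hm : h₃.E d e (Q.n c) := by
              rw [hd]
              exact ⟨v, hv, (((h₁.isSection v).1 _ _ hb).1).symm⟩
            obtain ⟨a₂, h1, rfl, rfl⟩ := (h₃.univA _ _ _ hm).exists
            exact ⟨a₂, h1, rfl, rfl, (h'.2 _ _).1 ⟨by rw [h1, h'.1], v, hv, hb⟩⟩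
          · rintro ⟨a₂, h1, rfl, rfl, hb⟩
            obtain ⟨-, v', hv₁, hv₂⟩ := (h'.2 _ _).2 hb
            have : v' = v := ((h₂.isSection w').2 _ ((h₂.isSection w').1 _ _ hv).1).unique hv₁ hv
            exact this ▸ hv₂
        constructor
        · intro hv
          exact ⟨(hd _ _).2 ⟨v, hv, rfl⟩, hE e v hv⟩
        · rintro ⟨h1, h2⟩
          obtain ⟨v', hv', hv''⟩ := (hd _ _).1 h1
          have : v' = v := h₁.ext_B hv'' fun c b => by rw [hE e v' hv', h2]
          exact this ▸ hv'
    mem := fun a => by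
      refine ⟨(hk a).1, h₂.l a |> V₁.n, ?_, ?_⟩
      · rw [(hk a).2.1]
        exact h₂.mem a
      · rw [(hk a).2.2]
        exact h₁.mem _
    univA := by
      rintro w a₂ a' ⟨h1, v, hv, hv'⟩
      obtain ⟨a₁, h1', h2', h3'⟩ := (h₁.univA _ _ _ hv').exists
      rw [← h1'] at hv
      obtain ⟨a, h1'', h2'', h3''⟩ := (h₂.univA _ _ _ hv).exists
      refine ⟨a, ⟨h1'', ?_, by rw [h3'', h3']⟩, ?_⟩
      · apply h₃.ext_A
        · rw [(hk a).1, h1'', h1]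
        · rw [(hk a).2.1, h2'']
        · rw [(hk a).2.2, h3'', h2']
      · rintro b ⟨rfl, rfl, hb⟩
        have e : h₂.k a = h₂.k b := by rw [h2'', (hk b).2.1]
        refine h₂.ext_A h1''.symm e.symm (h₁.ext_A ?_ ?_ ?_)
        · have hE := h₂.mem b
          rw [← e, ← h1''] at hE
          have hE' := h₂.mem a
          exact ((h₂.isSection _).2 _ ((h₂.isSection _).1 _ _ hE).1).unique hE hE'
        · rw [h3'', h2', (hk b).2.2]
        · rw [h3'', h3', hb] }

end Bispan

/-- The polynomial category `𝒫_G`: its objects are the finite `G`-sets, its morphisms are the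
isomorphism classes of bispans. -/
def PolynomialCat (G : Type u) [Group G] : Type (u + 1) := FinGSet G

namespace PolynomialCat

open CategoryTheory

variable {G : Type u} [Group G]

instance : Category (PolynomialCat G) where
  Hom X Y := Quotient (Bispan.setoid (G := G) X Y)
  id X := Quotient.mk _ (Bispan.id X)
  comp := Quotient.map₂ Bispan.comp fun _ _ hP _ _ hQ => Bispan.comp_isIso hP hQ
  id_comp := by
    rintro X Y ⟨P⟩
    exact Quotient.sound ((Bispan.compData _ _).isIso (Bispan.idCompData P))
  comp_id := by
    rintro X Y ⟨P⟩
    exact Quotient.sound ((Bispan.compData _ _).isIso (Bispan.compIdData P))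
  assoc := by
    rintro X Y Z W ⟨P⟩ ⟨Q⟩ ⟨R⟩
    exact Quotient.sound ((Bispan.assocData (Bispan.compData P Q) (Bispan.compData _ R)
      (Bispan.compData Q R)).isIso (Bispan.compData _ _))

/-- The object of `𝒫_G` given by a finite `G`-set. -/
def of (X : FinGSet G) : PolynomialCat G := X

/-- The morphism `[X ← A → B → Y]` of `𝒫_G`. -/
def ofBispan {X Y : FinGSet G} (P : Bispan X Y) : of X ⟶ of Y := Quotient.mk _ P

theorem ofBispan_comp {X Y Z : FinGSet G} {P : Bispan X Y} {Q : Bispan Y Z} {V : Bispan X Z}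
    (h : Bispan.CompData P Q V) : ofBispan P ≫ ofBispan Q = ofBispan V :=
  Quotient.sound ((Bispan.compData P Q).isIso h)

theorem ofBispan_id (X : FinGSet G) : ofBispan (Bispan.id X) = 𝟙 (of X) := rfl

/-- The morphism `T_f = [X ← X → X → Y]`. -/
def T {X Y : FinGSet G} (f : X →[G] Y) : of X ⟶ of Y := ofBispan ⟨X, X, .id G, .id G, f⟩

/-- The morphism `N_f = [X ← X → Y → Y]`. -/
def N {X Y : FinGSet G} (f : X →[G] Y) : of X ⟶ of Y := ofBispan ⟨X, Y, .id G, f, .id G⟩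

/-- The morphism `R_f = [Y ← X → X → X]`. -/
def R {X Y : FinGSet G} (f : X →[G] Y) : of Y ⟶ of X := ofBispan ⟨X, X, f, .id G, .id G⟩

/-- A commutative square of finite `G`-sets with `g ∘ p = f ∘ q` which is a pullback square. -/
structure IsPullback {E X X' Y : FinGSet G} (p : E →[G] X') (q : E →[G] X) (g : X' →[G] Y)
    (f : X →[G] Y) : Prop where
  comm : ∀ e, g (p e) = f (q e)
  lift : ∀ x' x, g x' = f x → ∃! e, p e = x' ∧ q e = x

/-- An exponential diagram: `π` is the dependent product of `g` along `f`, the map `f'` is the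
pullback of `f` along `π`, and `ε` is the evaluation map. -/
structure IsExponential {A B X Y Z : FinGSet G} (ε : A →[G] X) (f' : A →[G] B) (π : B →[G] Z)
    (g : X →[G] Y) (f : Y →[G] Z) : Prop where
  isPullback : IsPullback f' (g.comp ε) π f
  univ : ∀ z (s : Y → X → Prop), (∀ y x, s y x → f y = z ∧ g x = y) →
    (∀ y, f y = z → ∃! x, s y x) →
    ∃! b, π b = z ∧ ∀ y x, s y x ↔ ∃ a, f' a = b ∧ g (ε a) = y ∧ ε a = x

/-- Composition of spans. -/
def spanCompData {A C E X Y Z : FinGSet G} {p : E →[G] A} {q : E →[G] C} {t : A →[G] Y}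
    {r' : C →[G] Y} (h : IsPullback p q t r') (r : A →[G] X) (t' : C →[G] Z) :
    Bispan.CompData ⟨A, A, r, .id G, t⟩ ⟨C, C, r', .id G, t'⟩
      ⟨E, E, r.comp p, .id G, t'.comp q⟩ where
  u := q
  E := fun e c b => q e = c ∧ p e = b
  k := q
  l := p
  u_smul g w := map_smul q g w
  E_smul g w c b H := ⟨(map_smul q g w).trans (congrArg (g • ·) H.1),
    (map_smul p g w).trans (congrArg (g • ·) H.2)⟩
  k_smul g w := map_smul q g w
  l_smul g w := map_smul p g w
  t_eq _ := rfl
  r_eq _ := rfl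
  isSection w := by
    refine ⟨?_, ?_⟩
    · rintro c b ⟨rfl, rfl⟩
      exact ⟨rfl, h.comm w⟩
    · rintro c hc
      exact ⟨p w, ⟨hc.symm, rfl⟩, fun b hb => hb.2.symm⟩
  univ d R H := by
    obtain ⟨b, hb, hb'⟩ := H.2 d rfl
    obtain ⟨e, he, he'⟩ := h.lift b d (H.1 _ _ hb).2
    refine ⟨e, ⟨he.2, fun c b' => ⟨?_, fun H' => ?_⟩⟩, fun e' h' => he' _ ⟨?_, h'.1⟩⟩
    · rintro ⟨rfl, rfl⟩
      rw [he.1, he.2]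
      exact hb
    · obtain rfl : c = d := (H.1 _ _ H').1
      exact ⟨he.2, he.1.trans (hb' _ H').symm⟩
    · exact hb' _ ((h'.2 _ _).1 ⟨h'.1, rfl⟩)
  mem a := ⟨rfl, rfl⟩
  univA w c a' H := ⟨w, ⟨rfl, H.1, H.2⟩, fun a ha => ha.1⟩

/-- Composition with a bispan of the form `X ← A → Y → Y` on the left. -/
def leftCompData {A C D E X Y Z : FinGSet G} {p : E →[G] A} {q : E →[G] C} {m : A →[G] Y}
    {r' : C →[G] Y} (h : IsPullback p q m r') (r : A →[G] X) (m' : C →[G] D) (t' : D →[G] Z) :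
    Bispan.CompData ⟨A, Y, r, m, .id G⟩ ⟨C, D, r', m', t'⟩
      ⟨E, D, r.comp p, m'.comp q, t'⟩ where
  u := fun d => d
  E := fun d c b => m' c = d ∧ r' c = b
  k := q
  l := p
  u_smul _ _ := rfl
  E_smul g w c b H := ⟨(map_smul m' g c).trans (congrArg (g • ·) H.1),
    (map_smul r' g c).trans (congrArg (g • ·) H.2)⟩
  k_smul g w := map_smul q g w
  l_smul g w := map_smul p g w
  t_eq _ := rfl
  r_eq _ := rfl
  isSection w := by
    refine ⟨?_, ?_⟩
    · rintro c b ⟨rfl, rfl⟩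
      exact ⟨rfl, rfl⟩
    · rintro c hc
      exact ⟨r' c, ⟨hc, rfl⟩, fun b hb => hb.2.symm⟩
  univ d R H := by
    refine ⟨d, ⟨rfl, fun c b => ⟨?_, fun H' => ?_⟩⟩, fun e' h' => h'.1⟩
    · rintro ⟨h1, rfl⟩
      obtain ⟨b, hb, -⟩ := H.2 c h1
      have : b = r' c := (H.1 _ _ hb).2
      exact this ▸ hb
    · exact ⟨(H.1 _ _ H').1, (H.1 _ _ H').2.symm⟩
  mem a := ⟨rfl, (h.comm a).symm⟩
  univA w c a' H := by
    obtain ⟨e, he, he'⟩ := h.lift a' c H.2.symm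
    exact ⟨e, ⟨(congrArg m' he.2).trans H.1, he.2, he.1⟩, fun a ha => he' _ ⟨ha.2.2, ha.2.1⟩⟩

/-- Composition of `T_g` and `N_f`. -/
def exponentialCompData {A B X Y Z : FinGSet G} {ε : A →[G] X} {f' : A →[G] B} {π : B →[G] Z}
    {g : X →[G] Y} {f : Y →[G] Z} (h : IsExponential ε f' π g f) :
    Bispan.CompData ⟨X, X, .id G, .id G, g⟩ ⟨Y, Z, .id G, f, .id G⟩ ⟨A, B, ε, f', π⟩ where
  u := π
  E := fun b y x => ∃ a, f' a = b ∧ g (ε a) = y ∧ ε a = x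
  k := g.comp ε
  l := ε
  u_smul c w := map_smul π c w
  E_smul c w y x H := by
    obtain ⟨a, rfl, rfl, rfl⟩ := H
    exact ⟨c • a, map_smul f' c a, by rw [map_smul, map_smul], map_smul ε c a⟩
  k_smul c w := map_smul (g.comp ε) c w
  l_smul c w := map_smul ε c w
  t_eq _ := rfl
  r_eq _ := rfl
  isSection w := by
    refine ⟨?_, ?_⟩
    · rintro c b ⟨a, rfl, rfl, rfl⟩
      exact ⟨(h.isPullback.comm a).symm, rfl⟩
    · rintro c hc
      obtain ⟨a, ha, ha'⟩ := h.isPullback.lift w c hc.symm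
      refine ⟨ε a, ⟨a, ha.1, ha.2, rfl⟩, ?_⟩
      rintro _ ⟨a₂, h1, h2, rfl⟩
      rw [ha' a₂ ⟨h1, h2⟩]
  univ d R H := by
    obtain ⟨b, hb, hb'⟩ := h.univ d R H.1 H.2
    exact ⟨b, ⟨hb.1, fun c x => (hb.2 c x).symm⟩,
      fun b₂ h₂ => hb' b₂ ⟨h₂.1, fun c x => (h₂.2 c x).symm⟩⟩
  mem a := ⟨a, rfl, rfl, rfl⟩
  univA w c a' H := by
    obtain ⟨a, rfl, rfl, h3⟩ := H
    refine ⟨a, ⟨rfl, rfl, h3⟩, fun a₂ h₂ => ?_⟩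
    exact (h.isPullback.lift _ _ (h.isPullback.comm a)).unique ⟨h₂.1, h₂.2.1⟩ ⟨rfl, rfl⟩

theorem IsPullback.id_left {X Y : FinGSet G} (f : X →[G] Y) : IsPullback f (.id G) (.id G) f :=
  ⟨fun _ => rfl, fun _ x h => ⟨x, ⟨h.symm, rfl⟩, fun _ he => he.2⟩⟩

theorem IsPullback.id_right {X Y : FinGSet G} (f : X →[G] Y) : IsPullback (.id G) f f (.id G) :=
  ⟨fun _ => rfl, fun x _ h => ⟨x, ⟨rfl, h⟩, fun _ he => he.1⟩⟩

theorem ofBispan_eq {X Y A B : FinGSet G} (h : A →[G] X) (g : A →[G] B) (f : B →[G] Y) :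
    ofBispan ⟨A, B, h, g, f⟩ = R h ≫ N g ≫ T f := by
  have h1 : N g ≫ T f = ofBispan ⟨A, B, .id G, g, f⟩ :=
    ofBispan_comp (leftCompData (IsPullback.id_right g) (.id G) (.id G) f)
  rw [h1]
  exact (ofBispan_comp (leftCompData (IsPullback.id_right (.id G)) h g f)).symm

theorem T_comp {X Y Z : FinGSet G} (g : X →[G] Y) (f : Y →[G] Z) : T g ≫ T f = T (f.comp g) :=
  ofBispan_comp (spanCompData (IsPullback.id_right g) (.id G) f)

theorem N_comp {X Y Z : FinGSet G} (g : X →[G] Y) (f : Y →[G] Z) : N g ≫ N f = N (f.comp g) :=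
  ofBispan_comp (leftCompData (IsPullback.id_right g) (.id G) f (.id G))

theorem R_comp {X Y Z : FinGSet G} (g : X →[G] Y) (f : Y →[G] Z) : R f ≫ R g = R (f.comp g) :=
  ofBispan_comp (spanCompData (IsPullback.id_left g) f (.id G))

theorem T_R {E X X' Y : FinGSet G} {p : E →[G] X'} {q : E →[G] X} {g : X' →[G] Y}
    {f : X →[G] Y} (h : IsPullback p q g f) : T g ≫ R f = R p ≫ T q :=
  (ofBispan_comp (spanCompData h (.id G) (.id G))).trans
    (ofBispan_comp (spanCompData (IsPullback.id_right (.id G)) p q)).symm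

theorem N_R {E X X' Y : FinGSet G} {p : E →[G] X'} {q : E →[G] X} {g : X' →[G] Y}
    {f : X →[G] Y} (h : IsPullback p q g f) : N g ≫ R f = R p ≫ N q :=
  (ofBispan_comp (leftCompData h (.id G) (.id G) (.id G))).trans
    (ofBispan_comp (leftCompData (IsPullback.id_right (.id G)) p q (.id G))).symm

theorem T_N {A B X Y Z : FinGSet G} {ε : A →[G] X} {f' : A →[G] B} {π : B →[G] Z}
    {g : X →[G] Y} {f : Y →[G] Z} (h : IsExponential ε f' π g f) :
    T g ≫ N f = R ε ≫ N f' ≫ T π :=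
  (ofBispan_comp (exponentialCompData h)).trans (ofBispan_eq ε f' π)

end PolynomialCat

/-- A `G`-semi-Tambara functor: a functor `𝒫_G → Set` that preserves finite products. The
terminal object of `𝒫_G` is `∅`, and the product of `X` and `Y` is `X ⨿ Y`, with projections
`R_inl` and `R_inr`. -/
structure SemiTambaraFunctor (G : Type u) [Group G] : Type (max (u + 1) (w + 1)) where
  toFunctor : CategoryTheory.Functor (PolynomialCat G) (Type w)
  nonempty_unique_empty : Nonempty (Unique (toFunctor.obj (.of (FinGSet.empty G))))
  bijective_sum : ∀ X Y : FinGSet G, Function.Bijective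
    (fun a : toFunctor.obj (.of (X.sum Y)) =>
      (toFunctor.map (PolynomialCat.R (X.inl Y)) a, toFunctor.map (PolynomialCat.R (X.inr Y)) a))

namespace SemiTambaraFunctor

open PolynomialCat FinGSet CategoryTheory

variable {G : Type u} [Group G] (S : SemiTambaraFunctor.{u, w} G)

/-- The value `S(X)` at a finite `G`-set `X`. -/
def val (X : FinGSet G) : Type w := S.toFunctor.obj (.of X)

variable {X Y Z X' Y' : FinGSet G}

/-- The function `S(X) → S(Y)` induced by a morphism of `𝒫_G`. -/
def map (φ : of X ⟶ of Y) (a : S.val X) : S.val Y := S.toFunctor.map φ a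

theorem map_id (a : S.val X) : S.map (𝟙 (of X)) a = a := S.toFunctor.map_id_apply (of X) a

theorem map_map (φ : of X ⟶ of Y) (ψ : of Y ⟶ of Z) (a : S.val X) :
    S.map ψ (S.map φ a) = S.map (φ ≫ ψ) a := (S.toFunctor.map_comp_apply φ ψ a).symm

/-- The transfer along `f`. -/
def tr (f : X →[G] Y) (a : S.val X) : S.val Y := S.map (T f) a

/-- The norm along `f`. -/
def nm (f : X →[G] Y) (a : S.val X) : S.val Y := S.map (N f) a

/-- The restriction along `f`. -/
def res (f : X →[G] Y) (a : S.val Y) : S.val X := S.map (R f) a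

theorem tr_id (a : S.val X) : S.tr (.id G) a = a := S.map_id a

theorem nm_id (a : S.val X) : S.nm (.id G) a = a := S.map_id a

theorem res_id (a : S.val X) : S.res (.id G) a = a := S.map_id a

theorem tr_tr (g : X →[G] Y) (f : Y →[G] Z) (a : S.val X) :
    S.tr f (S.tr g a) = S.tr (f.comp g) a := by
  unfold tr
  rw [map_map, T_comp]

theorem nm_nm (g : X →[G] Y) (f : Y →[G] Z) (a : S.val X) :
    S.nm f (S.nm g a) = S.nm (f.comp g) a := by
  unfold nm
  rw [map_map, N_comp]

theorem res_res (g : X →[G] Y) (f : Y →[G] Z) (a : S.val Z) :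
    S.res g (S.res f a) = S.res (f.comp g) a := by
  unfold res
  rw [map_map, R_comp]

theorem res_tr {E : FinGSet G} {p : E →[G] X'} {q : E →[G] X} {g : X' →[G] Y}
    {f : X →[G] Y} (h : IsPullback p q g f) (a : S.val X') :
    S.res f (S.tr g a) = S.tr q (S.res p a) := by
  unfold res tr
  rw [map_map, map_map, T_R h]

theorem res_nm {E : FinGSet G} {p : E →[G] X'} {q : E →[G] X} {g : X' →[G] Y}
    {f : X →[G] Y} (h : IsPullback p q g f) (a : S.val X') :
    S.res f (S.nm g a) = S.nm q (S.res p a) := by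
  unfold res nm
  rw [map_map, map_map, N_R h]

theorem nm_tr {A B : FinGSet G} {ε : A →[G] X} {f' : A →[G] B} {π : B →[G] Z}
    {g : X →[G] Y} {f : Y →[G] Z} (h : IsExponential ε f' π g f) (a : S.val X) :
    S.nm f (S.tr g a) = S.tr π (S.nm f' (S.res ε a)) := by
  unfold res nm tr
  rw [map_map, map_map, map_map, T_N h]

/-- The unique element of `S(∅)`. -/
noncomputable def point : S.val (empty G) := S.nonempty_unique_empty.some.default

theorem eq_point (a : S.val (empty G)) : a = S.point := S.nonempty_unique_empty.some.uniq a

/-- The element of `S(X ⨿ Y)` corresponding to a pair of elements of `S(X)` and `S(Y)`. -/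
noncomputable def pair (a : S.val X) (b : S.val Y) : S.val (X.sum Y) :=
  (Equiv.ofBijective _ (S.bijective_sum X Y)).symm (a, b)

theorem res_inl_pair (a : S.val X) (b : S.val Y) : S.res (X.inl Y) (S.pair a b) = a :=
  congrArg Prod.fst ((Equiv.ofBijective _ (S.bijective_sum X Y)).apply_symm_apply (a, b))

theorem res_inr_pair (a : S.val X) (b : S.val Y) : S.res (X.inr Y) (S.pair a b) = b :=
  congrArg Prod.snd ((Equiv.ofBijective _ (S.bijective_sum X Y)).apply_symm_apply (a, b))

theorem sum_ext {a b : S.val (X.sum Y)} (h1 : S.res (X.inl Y) a = S.res (X.inl Y) b)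
    (h2 : S.res (X.inr Y) a = S.res (X.inr Y) b) : a = b :=
  (S.bijective_sum X Y).1 (Prod.ext h1 h2)

theorem res_desc (f : X →[G] Z) (g : Y →[G] Z) (a : S.val Z) :
    S.res (desc f g) a = S.pair (S.res f a) (S.res g a) := by
  apply S.sum_ext
  · rw [res_inl_pair, res_res]
    rfl
  · rw [res_inr_pair, res_res]
    rfl

/-- The common properties of transfers and norms from which the monoid laws follow. -/
structure IsCovariant (M : ∀ {X Y : FinGSet G}, (X →[G] Y) → S.val X → S.val Y) : Prop where
  map_id : ∀ {X : FinGSet G} (a : S.val X), M (.id G) a = a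
  map_map : ∀ {X Y Z : FinGSet G} (g : X →[G] Y) (f : Y →[G] Z) (a : S.val X),
    M f (M g a) = M (f.comp g) a
  res_map : ∀ {E X X' Y : FinGSet G} {p : E →[G] X'} {q : E →[G] X} {g : X' →[G] Y}
    {f : X →[G] Y}, IsPullback p q g f → ∀ a : S.val X', S.res f (M g a) = M q (S.res p a)

theorem isCovariant_tr : S.IsCovariant S.tr := ⟨S.tr_id, S.tr_tr, S.res_tr⟩

theorem isCovariant_nm : S.IsCovariant S.nm := ⟨S.nm_id, S.nm_nm, S.res_nm⟩

namespace IsCovariant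

variable {S} {M : ∀ {X Y : FinGSet G}, (X →[G] Y) → S.val X → S.val Y}

theorem map_iso (hM : S.IsCovariant M) (f : X →[G] Y) (g : Y →[G] X) (hfg : ∀ y, f (g y) = y) (hgf : ∀ x, g (f x) = x)
    (a : S.val X) : M f a = S.res g a := by
  have h : IsPullback g (.id G) f (.id G) := ⟨hfg, fun x y h => ⟨y, ⟨by
    change f x = y at h
    rw [← h, hgf], rfl⟩, fun e he => he.2⟩⟩
  rw [← hM.map_id (S.res g a), ← hM.res_map h, S.res_id]

theorem map_sum (hM : S.IsCovariant M) (f : X →[G] X') (g : Y →[G] Y') (a : S.val X) (b : S.val Y) :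
    M (desc ((X'.inl Y').comp f) ((X'.inr Y').comp g)) (S.pair a b) =
      S.pair (M f a) (M g b) := by
  have h1 : IsPullback (X.inl Y) f (desc ((X'.inl Y').comp f) ((X'.inr Y').comp g))
      (X'.inl Y') := by
    refine ⟨fun _ => rfl, ?_⟩
    rintro (x | y) x' h
    · exact ⟨x, ⟨rfl, Sum.inl_injective h⟩, fun e he => Sum.inl_injective he.1⟩
    · exact (Sum.inr_ne_inl h).elim
  have h2 : IsPullback (X.inr Y) g (desc ((X'.inl Y').comp f) ((X'.inr Y').comp g))
      (X'.inr Y') := by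
    refine ⟨fun _ => rfl, ?_⟩
    rintro (x | y) x' h
    · exact (Sum.inl_ne_inr h).elim
    · exact ⟨y, ⟨rfl, Sum.inr_injective h⟩, fun e he => Sum.inr_injective he.1⟩
  apply S.sum_ext
  · rw [hM.res_map h1, res_inl_pair, res_inl_pair]
  · rw [hM.res_map h2, res_inr_pair, res_inr_pair]

theorem op_comm (hM : S.IsCovariant M) (a b : S.val X) : M X.fold (S.pair a b) = M X.fold (S.pair b a) := by
  have h : S.pair b a = M (desc (X.inr X) (X.inl X)) (S.pair a b) := by
    rw [hM.map_iso (desc (X.inr X) (X.inl X)) (desc (X.inr X) (X.inl X))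
      (by rintro (x | x) <;> rfl) (by rintro (x | x) <;> rfl), res_desc, res_inl_pair,
      res_inr_pair]
  rw [h, hM.map_map]
  congr 1
  ext (x | x) <;> rfl

theorem op_assoc (hM : S.IsCovariant M) (a b c : S.val X) : M X.fold (S.pair (M X.fold (S.pair a b)) c) =
    M X.fold (S.pair a (M X.fold (S.pair b c))) := by
  have h1 := hM.map_sum X.fold (.id G) (S.pair a b) c
  have h2 := hM.map_sum (.id G) X.fold a (S.pair b c)
  rw [hM.map_id] at h1 h2
  rw [← h1, ← h2]
  have h3 : S.pair a (S.pair b c) =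
      M (desc (desc (X.inl _) ((X.inr _).comp (X.inl X))) ((X.inr _).comp (X.inr X)))
        (S.pair (S.pair a b) c) := by
    rw [hM.map_iso _ (desc (((X.sum X).inl X).comp (X.inl X))
      (desc (((X.sum X).inl X).comp (X.inr X)) ((X.sum X).inr X)))
      (by rintro (x | x | x) <;> rfl) (by rintro ((x | x) | x) <;> rfl)]
    rw [res_desc, res_desc, ← S.res_res, ← S.res_res, res_inl_pair, res_inl_pair, res_inr_pair,
      res_inr_pair]
  rw [h3, hM.map_map, hM.map_map, hM.map_map]
  congr 1
  ext ((x | x) | x) <;> rfl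

theorem unit_op (hM : S.IsCovariant M) (a : S.val X) : M X.fold (S.pair (M X.fromEmpty S.point) a) = a := by
  have h1 := hM.map_sum X.fromEmpty (.id G) S.point a
  rw [hM.map_id] at h1
  rw [← h1, hM.map_map, hM.map_iso _ ((empty G).inr X) (fun _ => rfl), res_inr_pair]
  rintro (x | x)
  · exact isEmptyElim x
  · rfl

theorem res_op (hM : S.IsCovariant M) (f : X →[G] Y) (a b : S.val Y) :
    S.res f (M Y.fold (S.pair a b)) = M X.fold (S.pair (S.res f a) (S.res f b)) := by
  have h : IsPullback (desc ((Y.inl Y).comp f) ((Y.inr Y).comp f)) X.fold Y.fold f := by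
    refine ⟨by rintro (x | x) <;> rfl, ?_⟩
    rintro (y | y) x rfl
    · refine ⟨Sum.inl x, ⟨rfl, rfl⟩, ?_⟩
      rintro (x' | x') ⟨h1, h2⟩
      · exact congrArg Sum.inl h2
      · exact (Sum.inr_ne_inl h1).elim
    · refine ⟨Sum.inr x, ⟨rfl, rfl⟩, ?_⟩
      rintro (x' | x') ⟨h1, h2⟩
      · exact (Sum.inl_ne_inr h1).elim
      · exact congrArg Sum.inr h2
  rw [hM.res_map h, res_desc, ← S.res_res, ← S.res_res, res_inl_pair, res_inr_pair]

theorem op_pair (hM : S.IsCovariant M) (a a' : S.val X) (b b' : S.val Y) :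
    M (X.sum Y).fold (S.pair (S.pair a b) (S.pair a' b')) =
      S.pair (M X.fold (S.pair a a')) (M Y.fold (S.pair b b')) := by
  apply S.sum_ext
  · rw [hM.res_op, res_inl_pair, res_inl_pair, res_inl_pair]
  · rw [hM.res_op, res_inr_pair, res_inr_pair, res_inr_pair]

end IsCovariant

theorem isExponential_fold (X : FinGSet G) :
    IsExponential (desc ((X.inl (X.sum X)).comp X.fold) (X.inr (X.sum X))) (X.sum X).fold X.fold
      (desc ((X.inl X).comp (.id G)) ((X.inr X).comp X.fold)) X.fold := by
  refine ⟨⟨by rintro ((x | x) | (x | x)) <;> rfl, ?_⟩, fun z s h1 h2 => ?_⟩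
  · rintro b (y | y) h
    · refine ⟨Sum.inl b, ⟨rfl, congrArg Sum.inl h⟩, ?_⟩
      rintro (e | e) ⟨he, he'⟩
      · exact congrArg Sum.inl he
      · exact (Sum.inr_ne_inl he').elim
    · refine ⟨Sum.inr b, ⟨rfl, congrArg Sum.inr h⟩, ?_⟩
      rintro (e | e) ⟨he, he'⟩
      · exact (Sum.inl_ne_inr he').elim
      · exact congrArg Sum.inr he
  · obtain ⟨x₁, hx₁, hx₁'⟩ := h2 (Sum.inl z) rfl
    obtain ⟨x₂, hx₂, hx₂'⟩ := h2 (Sum.inr z) rfl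
    have e₁ := (h1 _ _ hx₁).2
    have e₂ := (h1 _ _ hx₂).2
    rcases x₁ with x | x
    swap
    · exact (Sum.inr_ne_inl e₁).elim
    rcases x₂ with y | b
    · exact (Sum.inl_ne_inr e₂).elim
    obtain rfl : x = z := Sum.inl_injective e₁
    have hb : X.fold b = x := Sum.inr_injective e₂
    refine ⟨b, ⟨hb, fun y w => ⟨fun hs => ?_, ?_⟩⟩, ?_⟩
    · rcases y with y | y
      · obtain rfl : y = x := (h1 _ _ hs).1
        exact ⟨Sum.inl b, rfl, congrArg Sum.inl hb, (congrArg Sum.inl hb).trans (hx₁' _ hs).symm⟩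
      · obtain rfl : y = x := (h1 _ _ hs).1
        exact ⟨Sum.inr b, rfl, congrArg Sum.inr hb, (hx₂' _ hs).symm⟩
    · rintro ⟨e | e, he, rfl, rfl⟩
      · obtain rfl : e = b := he
        subst hb
        exact hx₁
      · obtain rfl : e = b := he
        subst hb
        exact hx₂
    · rintro b' ⟨hb', H⟩
      have := hx₂' (Sum.inr b') ((H _ _).2 ⟨Sum.inr b', rfl, congrArg Sum.inr hb', rfl⟩)
      exact Sum.inr_injective this

theorem isExponential_fromEmpty (X : FinGSet G) :
    IsExponential ((empty G).sum X).fromEmpty (.id G) X.fromEmpty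
      (desc ((X.inl X).comp X.fromEmpty) ((X.inr X).comp (.id G))) X.fold := by
  refine ⟨⟨fun e => isEmptyElim e, fun b => isEmptyElim b⟩, fun z s h1 h2 => ?_⟩
  obtain ⟨x, hx, -⟩ := h2 (Sum.inl z) rfl
  have := (h1 _ _ hx).2
  rcases x with x | x
  · exact isEmptyElim x
  · exact (Sum.inr_ne_inl this).elim

theorem nm_fold_pair_tr_fold (a b c : S.val X) :
    S.nm X.fold (S.pair a (S.tr X.fold (S.pair b c))) =
      S.tr X.fold (S.pair (S.nm X.fold (S.pair a b)) (S.nm X.fold (S.pair a c))) := by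
  have h := S.isCovariant_tr.map_sum (.id G) X.fold a (S.pair b c)
  rw [S.tr_id] at h
  rw [← h, S.nm_tr (isExponential_fold X), res_desc, ← S.res_res, res_inl_pair, res_inr_pair,
    ← S.isCovariant_nm.op_pair]
  congr 3
  apply S.sum_ext
  · rw [res_res, res_inl_pair]
    exact S.res_id a
  · rw [res_res, res_inr_pair]
    exact S.res_id a

theorem nm_fold_pair_tr_fromEmpty (a : S.val X) :
    S.nm X.fold (S.pair (S.tr X.fromEmpty S.point) a) = S.tr X.fromEmpty S.point := by
  have h := S.isCovariant_tr.map_sum X.fromEmpty (.id G) S.point a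
  rw [S.tr_id] at h
  rw [← h, S.nm_tr (isExponential_fromEmpty X)]
  exact congrArg _ (S.eq_point _)

noncomputable instance (X : FinGSet G) : Add (S.val X) := ⟨fun a b => S.tr X.fold (S.pair a b)⟩

noncomputable instance (X : FinGSet G) : Mul (S.val X) := ⟨fun a b => S.nm X.fold (S.pair a b)⟩

noncomputable instance (X : FinGSet G) : Zero (S.val X) := ⟨S.tr X.fromEmpty S.point⟩

noncomputable instance (X : FinGSet G) : One (S.val X) := ⟨S.nm X.fromEmpty S.point⟩

/-- The commutative semiring structure on `S(X)`, with addition `tr_∇`, multiplication `nm_∇`,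
zero `tr_!` and one `nm_!`. -/
noncomputable instance (X : FinGSet G) : CommSemiring (S.val X) where
  nsmul := nsmulRec
  add_assoc := S.isCovariant_tr.op_assoc
  zero_add := S.isCovariant_tr.unit_op
  add_zero a := (S.isCovariant_tr.op_comm _ _).trans (S.isCovariant_tr.unit_op a)
  add_comm := S.isCovariant_tr.op_comm
  mul_assoc := S.isCovariant_nm.op_assoc
  one_mul := S.isCovariant_nm.unit_op
  mul_one a := (S.isCovariant_nm.op_comm _ _).trans (S.isCovariant_nm.unit_op a)
  mul_comm := S.isCovariant_nm.op_comm
  zero_mul := S.nm_fold_pair_tr_fromEmpty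
  mul_zero a := (S.isCovariant_nm.op_comm _ _).trans (S.nm_fold_pair_tr_fromEmpty a)
  left_distrib := S.nm_fold_pair_tr_fold
  right_distrib a b c := by
    refine (S.isCovariant_nm.op_comm _ _).trans ((S.nm_fold_pair_tr_fold c a b).trans ?_)
    rw [S.isCovariant_nm.op_comm c a, S.isCovariant_nm.op_comm c b]
    rfl

theorem add_def (a b : S.val X) : a + b = S.tr X.fold (S.pair a b) := rfl

theorem mul_def (a b : S.val X) : a * b = S.nm X.fold (S.pair a b) := rfl

theorem zero_def : (0 : S.val X) = S.tr X.fromEmpty S.point := rfl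

theorem one_def : (1 : S.val X) = S.nm X.fromEmpty S.point := rfl

end SemiTambaraFunctor

/-- A `G`-Tambara functor: a `G`-semi-Tambara functor all of whose values are rings. -/
structure TambaraFunctor (G : Type u) [Group G] extends SemiTambaraFunctor.{u, w} G where
  exists_neg : ∀ (X : FinGSet G) (a : toSemiTambaraFunctor.val X), ∃ b, b + a = 0

namespace TambaraFunctor

variable {G : Type u} [Group G]

/-- The value `T(X)` at a finite `G`-set `X`. -/
abbrev val (T : TambaraFunctor.{u, w} G) (X : FinGSet G) : Type w := T.toSemiTambaraFunctor.val X

noncomputable instance (T : TambaraFunctor.{u, w} G) (X : FinGSet G) : Neg (T.val X) :=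
  ⟨fun a => (T.exists_neg X a).choose⟩

/-- The commutative ring structure on `T(X)`. -/
noncomputable instance (T : TambaraFunctor.{u, w} G) (X : FinGSet G) : CommRing (T.val X) :=
  { (inferInstance : CommSemiring (T.toSemiTambaraFunctor.val X)) with
    zsmul := zsmulRec
    neg_add_cancel := fun a => (T.exists_neg X a).choose_spec }

variable [Finite G] (T : TambaraFunctor.{u, w} G)

/-- The value `T(G/H)`. -/
abbrev level (H : Subgroup G) : Type w := T.val (.orbit H)

end TambaraFunctor

namespace FinGSet

variable {G : Type u} [Group G] [Finite G]

/-- The quotient map `G/H → G/K`, `x H ↦ x K`, for `H ≤ K`. -/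
def orbitMap {H K : Subgroup G} (h : H ≤ K) : orbit H →[G] orbit K where
  toFun := Subgroup.quotientMapOfLE h
  map_smul' := by
    rintro g ⟨x⟩
    rfl

/-- The conjugate subgroup `g H g⁻¹`. -/
def conjSubgroup (g : G) (H : Subgroup G) : Subgroup G := H.map (MulAut.conj g).toMonoidHom

/-- The isomorphism `G/H → G/gHg⁻¹`, `x H ↦ x g⁻¹ (g H g⁻¹)`. -/
def orbitConj (g : G) (H : Subgroup G) : orbit H →[G] orbit (conjSubgroup g H) where
  toFun := Quotient.map' (fun x => x * g⁻¹) (by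
    intro x y hxy
    rw [QuotientGroup.leftRel_apply] at hxy ⊢
    exact ⟨x⁻¹ * y, hxy, by simp [mul_assoc]⟩)
  map_smul' := by
    rintro c ⟨x⟩
    exact congrArg Quotient.mk'' (mul_assoc c x g⁻¹)

end FinGSet

/-- A Tambara ideal of `T`: ideals `I(G/H) ⊆ T(G/H)` for all `H ≤ G`, closed under restrictions,
transfers, norms and conjugations. -/
@[ext]
structure TambaraIdeal {G : Type u} [Group G] [Finite G] (T : TambaraFunctor.{u, w} G) where
  level : ∀ H : Subgroup G, Ideal (T.level H)
  res_mem : ∀ {H K : Subgroup G} (h : H ≤ K) {x : T.level K}, x ∈ level K →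
    T.res (FinGSet.orbitMap h) x ∈ level H
  tr_mem : ∀ {H K : Subgroup G} (h : H ≤ K) {x : T.level H}, x ∈ level H →
    T.tr (FinGSet.orbitMap h) x ∈ level K
  nm_mem : ∀ {H K : Subgroup G} (h : H ≤ K) {x : T.level H}, x ∈ level H →
    T.nm (FinGSet.orbitMap h) x ∈ level K
  conj_mem : ∀ (g : G) {H : Subgroup G} {x : T.level H}, x ∈ level H →
    T.tr (FinGSet.orbitConj g H) x ∈ level (FinGSet.conjSubgroup g H)

namespace TambaraIdeal

variable {G : Type u} [Group G] [Finite G] {T : TambaraFunctor.{u, w} G}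

/-- Tambara ideals are ordered by levelwise inclusion. -/
noncomputable instance : PartialOrder (TambaraIdeal T) :=
  PartialOrder.lift TambaraIdeal.level fun _ _ h => TambaraIdeal.ext h

/-- The product `IJ`: the intersection of all Tambara ideals `K` such that
`I(G/H) J(G/H) ⊆ K(G/H)` for all `H`. -/
noncomputable instance : Mul (TambaraIdeal T) where
  mul I J :=
    { level := fun H => ⨅ (K : TambaraIdeal T) (_ : ∀ L, I.level L * J.level L ≤ K.level L),
        K.level H
      res_mem := by
        intro H K h x hx
        simp only [Submodule.mem_iInf] at hx ⊢
        exact fun I hI => I.res_mem h (hx I hI)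
      tr_mem := by
        intro H K h x hx
        simp only [Submodule.mem_iInf] at hx ⊢
        exact fun I hI => I.tr_mem h (hx I hI)
      nm_mem := by
        intro H K h x hx
        simp only [Submodule.mem_iInf] at hx ⊢
        exact fun I hI => I.nm_mem h (hx I hI)
      conj_mem := by
        intro g H x hx
        simp only [Submodule.mem_iInf] at hx ⊢
        exact fun I hI => I.conj_mem g (hx I hI) }

/-- A Tambara ideal `P` is prime if it is proper and `IJ ⊆ P` implies `I ⊆ P` or `J ⊆ P`. -/
def IsPrime (P : TambaraIdeal T) : Prop :=
  (∃ H, P.level H ≠ ⊤) ∧ ∀ I J : TambaraIdeal T, I * J ≤ P → I ≤ P ∨ J ≤ P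

end TambaraIdeal

/-! The argument follows the one for commutative rings. Every closure condition on a Tambara ideal
involves a single element, so the levelwise union of a nonempty chain is again an ideal
(`chainSup`), and Zorn's lemma applies starting from the zero ideal. For primality, suppose `I` and
`J` are not contained in a maximal `p`. Then `p + I` and `p + J` are strictly larger than `p`, so
they contain elements `a + b` and `c + d` of `S` with `a`, `c` in `p`, `b` in `I` and `d` in `J`.
The product lies in `S`, and also in `p`, because `b * d` lies in `I * J ≤ p` and the other terms
have a factor in `p`. An element of `S` also shows that `p` is proper.

The substance is that the levelwise sum of two ideals is an ideal (`sup`), where closure under norms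
is not formal because norms are not additive. Write `a + b` as the transfer along the fold map of
the pair `(a, b)` and exchange norm and transfer. The norm of `a + b` along `f` becomes a transfer
from the `G`-set of all ways to choose the left or the right summand at each point of a fibre of
`f`. The constantly left choices contribute the norm of `a` (`nm_add`). Every other choice picks `b`
somewhere, so on its orbit the norm has a factor that is the norm of a restriction of `b`. Hence the
norm of `a + b` differs from that of `a` by an element of any ideal containing `b`
(`exists_nm_add_eq`).

Ideals are given only on orbits and only for quotient maps and conjugations, whereas these formulas
involve arbitrary finite `G`-sets. The link is that every map of orbits factors through the given
ones, and that transfers and norms split as sums and products over orbits. -/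

/-! ### Complements and pullbacks of finite `G`-sets -/

namespace FinGSet

variable {G : Type u} [Group G]

/-- The sub-`G`-set of a finite `G`-set `X` cut out by an invariant predicate. -/
def sub (X : FinGSet G) (p : X → Prop) (hp : ∀ (g : G) x, p x → p (g • x)) : FinGSet G :=
  letI : MulAction G {x : X // p x} :=
    { smul := fun g x => ⟨g • x.1, hp g x.1 x.2⟩
      one_smul := fun x => Subtype.ext (one_smul G x.1)
      mul_smul := fun g h x => Subtype.ext (mul_smul g h x.1) }
  ⟨{x : X // p x}⟩

/-- The inclusion of a sub-`G`-set. -/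
def subIncl (X : FinGSet G) (p : X → Prop) (hp : ∀ (g : G) x, p x → p (g • x)) :
    X.sub p hp →[G] X where
  toFun := Subtype.val
  map_smul' := fun _ _ => rfl

/-- The complement of the range of an equivariant map. -/
def compl {U X : FinGSet G} (i : U →[G] X) : FinGSet G :=
  X.sub (fun x => x ∉ Set.range i) (by
    rintro g x hx ⟨u, hu⟩
    exact hx ⟨g⁻¹ • u, by rw [map_smul, hu, inv_smul_smul]⟩)

/-- The inclusion of the complement of the range of an equivariant map. -/
def complIncl {U X : FinGSet G} (i : U →[G] X) : compl i →[G] X := X.subIncl _ _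

theorem desc_complIncl_bijective {U X : FinGSet G} (i : U →[G] X) (hi : Function.Injective i) :
    Function.Bijective (desc i (complIncl i)) := by
  constructor
  · rintro (x | x) (y | y) h
    · exact congrArg Sum.inl (hi h)
    · exact (y.2 ⟨x, h⟩).elim
    · exact (x.2 ⟨y, h.symm⟩).elim
    · exact congrArg Sum.inr (Subtype.ext h)
  · intro x
    by_cases hx : x ∈ Set.range i
    · obtain ⟨u, rfl⟩ := hx
      exact ⟨Sum.inl u, rfl⟩
    · exact ⟨Sum.inr ⟨x, hx⟩, rfl⟩

/-- The product of two finite `G`-sets. -/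
def prod (X Y : FinGSet G) : FinGSet G := ⟨X × Y⟩

/-- The pullback of two equivariant maps. -/
def pullback {X X' Y : FinGSet G} (g : X' →[G] Y) (f : X →[G] Y) : FinGSet G :=
  (X'.prod X).sub (fun z => g z.1 = f z.2) (fun c z h =>
    (map_smul g c z.1).trans ((congrArg (c • ·) h).trans (map_smul f c z.2).symm))

/-- The first projection of a pullback. -/
def pullbackFst {X X' Y : FinGSet G} (g : X' →[G] Y) (f : X →[G] Y) : pullback g f →[G] X' where
  toFun z := z.1.1
  map_smul' _ _ := rfl

/-- The second projection of a pullback. -/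
def pullbackSnd {X X' Y : FinGSet G} (g : X' →[G] Y) (f : X →[G] Y) : pullback g f →[G] X where
  toFun z := z.1.2
  map_smul' _ _ := rfl

theorem isPullback_pullback {X X' Y : FinGSet G} (g : X' →[G] Y) (f : X →[G] Y) :
    PolynomialCat.IsPullback (pullbackFst g f) (pullbackSnd g f) g f :=
  ⟨fun e => e.2, fun x' x h => ⟨⟨(x', x), h⟩, ⟨rfl, rfl⟩, fun _ he =>
    Subtype.ext (Prod.ext he.1 he.2)⟩⟩

/-! ### Maps between orbits -/

section Orbit

variable [Finite G]

/-- The map `G/Stab(x) → X`, `g ↦ g • x`. -/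
def ofStabilizer {X : FinGSet G} (x : X) : orbit (MulAction.stabilizer G x) →[G] X where
  toFun := MulAction.ofQuotientStabilizer G x
  map_smul' := fun g y => MulAction.ofQuotientStabilizer_smul G x g y

theorem ofStabilizer_injective {X : FinGSet G} (x : X) : Function.Injective (ofStabilizer x) :=
  MulAction.injective_ofQuotientStabilizer G x

/-- The base point of `G/H`. -/
def basePoint (H : Subgroup G) : orbit H := QuotientGroup.mk (1 : G)

theorem orbit_hom_ext {H : Subgroup G} {X : FinGSet G} {f g : orbit H →[G] X}
    (h : f (basePoint H) = g (basePoint H)) : f = g := by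
  ext x
  obtain ⟨x, rfl⟩ := QuotientGroup.mk_surjective x
  have hx : (QuotientGroup.mk x : G ⧸ H) = x • basePoint H :=
    congrArg QuotientGroup.mk (mul_one x).symm
  rw [hx, map_smul, map_smul, h]

/-- An element of `H` fixes the base point of `G/H`, hence fixes its image, whose stabilizer is `g K
g⁻¹`. -/
theorem le_of_smul_basePoint {H K : Subgroup G} (φ : orbit H →[G] orbit K) {g : G}
    (hg : φ (basePoint H) = g • basePoint K) {h : G} (hh : h ∈ H) : g⁻¹ * h * g ∈ K := by
  have h1 : h • basePoint H = basePoint H :=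
    (QuotientGroup.eq.2 (by simpa using hh) :
      (QuotientGroup.mk (h * 1) : G ⧸ H) = QuotientGroup.mk 1)
  have h2 := congrArg φ h1
  rw [map_smul, hg, smul_smul] at h2
  have h3 : (QuotientGroup.mk (h * g * 1) : G ⧸ K) = QuotientGroup.mk (g * 1) := h2
  have := K.inv_mem (QuotientGroup.eq.1 h3)
  simpa [mul_assoc] using this

theorem exists_smul_basePoint {H : Subgroup G} (x : orbit H) : ∃ g : G, x = g • basePoint H := by
  obtain ⟨x, rfl⟩ := QuotientGroup.mk_surjective x
  exact ⟨x, congrArg QuotientGroup.mk (mul_one x).symm⟩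

/-- The range of `j` is `G`-stable and `G/H` is a single orbit, so it is enough that the base point
lands in the range. -/
theorem exists_comp_eq_of_injective {H : Subgroup G} {U X : FinGSet G} (j : U →[G] X)
    (hj : Function.Injective j) (φ : orbit H →[G] X) (h : φ (basePoint H) ∈ Set.range j) :
    ∃ χ : orbit H →[G] U, j.comp χ = φ := by
  have h' : ∀ x, ∃ u, j u = φ x := fun x => by
    obtain ⟨g, rfl⟩ := exists_smul_basePoint x
    obtain ⟨u, hu⟩ := h
    exact ⟨g • u, by rw [map_smul, map_smul, hu]⟩
  choose χ hχ using h'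
  exact ⟨⟨χ, fun g x => hj (by rw [hχ, map_smul]; exact ((map_smul j g _).trans (by rw [hχ])).symm)⟩,
    DFunLike.ext _ _ hχ⟩

/-- Every map `G/H → G/K` is a conjugation followed by a quotient map. -/
theorem exists_orbitMap_comp_orbitConj {H K : Subgroup G} (φ : orbit H →[G] orbit K) :
    ∃ (g : G) (h : conjSubgroup g H ≤ K), φ = (orbitMap h).comp (orbitConj g H) := by
  obtain ⟨g, hg⟩ := exists_smul_basePoint (φ (basePoint H))
  -- `orbitConj` multiplies by the inverse on the right, so conjugating by `g⁻¹` sends the base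
  -- point to the class of `g`.
  refine ⟨g⁻¹, ?_, orbit_hom_ext ?_⟩
  · rintro _ ⟨x, hx, rfl⟩
    simpa using le_of_smul_basePoint φ hg hx
  · rw [hg]
    change (QuotientGroup.mk (g * 1) : G ⧸ K) = QuotientGroup.mk (1 * g⁻¹⁻¹)
    simp

theorem orbitConj_bijective (g : G) (H : Subgroup G) : Function.Bijective (orbitConj g H) := by
  constructor
  · intro x y hxy
    obtain ⟨x, rfl⟩ := QuotientGroup.mk_surjective x
    obtain ⟨y, rfl⟩ := QuotientGroup.mk_surjective y
    have h : (QuotientGroup.mk (x * g⁻¹) : G ⧸ conjSubgroup g H) = QuotientGroup.mk (y * g⁻¹) := hxy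
    obtain ⟨z, hz, hz'⟩ := QuotientGroup.eq.1 h
    have : z = x⁻¹ * y := by
      have : g * z * g⁻¹ = g * (x⁻¹ * y) * g⁻¹ := by
        simpa [mul_assoc] using hz'
      simpa using this
    exact QuotientGroup.eq.2 (this ▸ hz)
  · intro y
    obtain ⟨y, rfl⟩ := QuotientGroup.mk_surjective y
    exact ⟨QuotientGroup.mk (y * g), congrArg QuotientGroup.mk (mul_inv_cancel_right y g)⟩

/-- Every map `G/H → G/K` is a quotient map followed by the inverse of a conjugation. -/
theorem exists_invHom_comp_orbitMap {H K : Subgroup G} (φ : orbit H →[G] orbit K) :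
    ∃ (g : G) (h : H ≤ conjSubgroup g K),
      φ = (Bispan.invHom _ (orbitConj_bijective g K)).comp (orbitMap h) := by
  obtain ⟨g, hg⟩ := exists_smul_basePoint (φ (basePoint H))
  refine ⟨g, ?_, orbit_hom_ext ?_⟩
  · intro x hx
    exact ⟨_, le_of_smul_basePoint φ hg hx, by simp [mul_assoc]⟩
  · apply (orbitConj_bijective g K).1
    rw [hg]
    refine Eq.trans ?_ (Bispan.apply_invHom _ (orbitConj_bijective g K) _).symm
    change (QuotientGroup.mk (g * 1 * g⁻¹) : G ⧸ conjSubgroup g K) = QuotientGroup.mk 1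
    simp

end Orbit

end FinGSet

/-! ### Splitting of transfers and norms, and their values at zero -/

namespace SemiTambaraFunctor

open PolynomialCat FinGSet

variable {G : Type u} [Group G] {S : SemiTambaraFunctor.{u, w} G} {X Y Z X' Y' : FinGSet G}

namespace IsCovariant

variable {M : ∀ {X Y : FinGSet G}, (X →[G] Y) → S.val X → S.val Y}

/-- In particular transfer and norm agree along an isomorphism, which lets a conjugation be read as
a transfer, a norm or a restriction. -/
theorem map_eq_res_invHom (hM : S.IsCovariant M) (f : X →[G] Y) (hf : Function.Bijective f)
    (a : S.val X) : M f a = S.res (Bispan.invHom f hf) a :=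
  hM.map_iso _ _ (Bispan.apply_invHom f hf) (Bispan.invHom_apply f hf) a

theorem map_res_of_bijective (hM : S.IsCovariant M) (f : X →[G] Y) (hf : Function.Bijective f)
    (a : S.val Y) : M f (S.res f a) = a := by
  rw [hM.map_eq_res_invHom f hf, res_res]
  have : f.comp (Bispan.invHom f hf) = .id G := by
    ext y
    exact Bispan.apply_invHom f hf y
  rw [this, res_id]

theorem map_desc_pair (hM : S.IsCovariant M) (f : X →[G] Z) (g : Y →[G] Z) (a : S.val X)
    (b : S.val Y) : M (desc f g) (S.pair a b) = M Z.fold (S.pair (M f a) (M g b)) := by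
  rw [← hM.map_sum, hM.map_map]
  congr 1
  ext (x | y) <;> rfl

/-- `X` is the disjoint union of `U` and its complement, and `M` turns disjoint unions into the fold
operation. Applied to an orbit in `X`, this peels one summand off a transfer or one factor off a
norm. -/
theorem map_split (hM : S.IsCovariant M) {U : FinGSet G} (i : U →[G] X)
    (hi : Function.Injective i) (f : X →[G] Y) (a : S.val X) :
    M f a = M Y.fold (S.pair (M (f.comp i) (S.res i a))
      (M (f.comp (complIncl i)) (S.res (complIncl i) a))) := by
  conv_lhs => rw [← hM.map_res_of_bijective _ (desc_complIncl_bijective i hi) a, hM.map_map,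
    res_desc]
  rw [← hM.map_desc_pair]
  congr 1
  ext (x | y) <;> rfl

/-- Both sides are the value of `M` along the map `X ⨿ X → Y` that is `f` on each copy. -/
theorem map_op (hM : S.IsCovariant M) (f : X →[G] Y) (a b : S.val X) :
    M f (M X.fold (S.pair a b)) = M Y.fold (S.pair (M f a) (M f b)) := by
  rw [hM.map_map, ← hM.map_desc_pair]
  congr 1
  ext (x | y) <;> rfl

end IsCovariant

variable (S)

theorem res_add (f : X →[G] Y) (a b : S.val Y) : S.res f (a + b) = S.res f a + S.res f b :=
  S.isCovariant_tr.res_op f a b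

theorem tr_add (f : X →[G] Y) (a b : S.val X) : S.tr f (a + b) = S.tr f a + S.tr f b :=
  S.isCovariant_tr.map_op f a b

theorem tr_split {U : FinGSet G} (i : U →[G] X) (hi : Function.Injective i) (f : X →[G] Y)
    (a : S.val X) : S.tr f a = S.tr (f.comp i) (S.res i a) +
      S.tr (f.comp (complIncl i)) (S.res (complIncl i) a) :=
  S.isCovariant_tr.map_split i hi f a

theorem nm_split {U : FinGSet G} (i : U →[G] X) (hi : Function.Injective i) (f : X →[G] Y)
    (a : S.val X) : S.nm f a = S.nm (f.comp i) (S.res i a) *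
      S.nm (f.comp (complIncl i)) (S.res (complIncl i) a) :=
  S.isCovariant_nm.map_split i hi f a

/-- Such an `X` is isomorphic to `∅`, where the functor has a single value, and zero is by
definition the transfer of that value. -/
theorem tr_of_isEmpty [IsEmpty X] (f : X →[G] Y) (a : S.val X) : S.tr f a = 0 := by
  have h : Function.Bijective X.fromEmpty :=
    ⟨fun x => isEmptyElim x, fun x => (IsEmpty.false x).elim⟩
  rw [← S.isCovariant_tr.map_res_of_bijective _ h a, tr_tr, S.eq_point (S.res _ a), zero_def]
  congr 1
  ext x
  exact isEmptyElim x

theorem tr_zero (f : X →[G] Y) : S.tr f 0 = 0 := by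
  rw [zero_def, tr_tr]
  exact S.tr_of_isEmpty (X := empty G) _ _

theorem res_zero (f : X →[G] Y) : S.res f 0 = 0 := by
  have h : IsPullback (.id G) X.fromEmpty Y.fromEmpty f :=
    ⟨fun e => isEmptyElim e, fun e => isEmptyElim e⟩
  rw [zero_def, S.res_tr h, res_id, zero_def]

/-- Zero is a transfer from `∅`. Over a nonempty fibre of `f` the map `∅ → X` has no section, so the
dependent product is empty and the norm is again a transfer from `∅`. Without surjectivity empty
fibres would contribute; the norm along `∅ → Y` is `1`. -/
theorem nm_zero (f : X →[G] Y) (hf : Function.Surjective f) : S.nm f 0 = 0 := by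
  have h : IsExponential (.id G) (.id G) Y.fromEmpty X.fromEmpty f := by
    refine ⟨⟨fun e => isEmptyElim e, fun e => isEmptyElim e⟩, fun z s _ h2 => ?_⟩
    obtain ⟨y, hy⟩ := hf z
    exact isEmptyElim (h2 y hy).choose
  rw [zero_def, S.nm_tr h, zero_def]
  exact congrArg _ (S.eq_point _)

end SemiTambaraFunctor

/-! ### The norm of a sum -/

namespace SemiTambaraFunctor

open PolynomialCat FinGSet

variable {G : Type u} [Group G] (S : SemiTambaraFunctor.{u, w} G) {X Y : FinGSet G}

theorem map_ofBispan (V : Bispan X Y) (a : S.val X) :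
    S.map (ofBispan V) a = S.tr V.t (S.nm V.n (S.res V.r a)) := by
  unfold tr nm res
  rw [map_map, map_map, ← ofBispan_eq]

/-- The composite of `T_∇` and `N_f`. -/
def normSum (f : X →[G] Y) : Bispan (X.sum X) Y :=
  Bispan.comp ⟨X.sum X, X.sum X, .id G, .id G, X.fold⟩ ⟨X, Y, .id G, f, .id G⟩

/-- The sections of `∇` over the fibres of `f` with values in the left summand. -/
def normSumLeft (f : X →[G] Y) : Y →[G] (normSum f).B where
  toFun y :=
    { d := y
      R := fun c b => f c = y ∧ b = (Sum.inl c : X ⊕ X)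
      isSection := by
        refine ⟨?_, fun c hc => ⟨(Sum.inl c : X ⊕ X), ⟨hc, rfl⟩, fun b hb => hb.2⟩⟩
        rintro c b ⟨rfl, rfl⟩
        exact ⟨rfl, rfl⟩ }
  map_smul' g y := by
    refine Bispan.CompB.ext rfl (funext fun c => funext fun b => propext ?_)
    change (f c = g • y ∧ b = (Sum.inl c : X ⊕ X)) ↔
      (f (g⁻¹ • c) = y ∧ g⁻¹ • b = (Sum.inl (g⁻¹ • c) : X ⊕ X))
    have hb : b = (Sum.inl c : X ⊕ X) ↔ g⁻¹ • b = (Sum.inl (g⁻¹ • c) : X ⊕ X) :=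
      (smul_left_cancel_iff (β := X.sum X) g⁻¹).symm
    rw [map_smul, inv_smul_eq_iff, hb]

/-- The points of the fibres of `f`, with the sections in `normSumLeft`. -/
def normSumLeftPoint (f : X →[G] Y) : X →[G] (normSum f).A where
  toFun x := ⟨normSumLeft f (f x), x, (Sum.inl x : X ⊕ X), ⟨rfl, rfl⟩⟩
  map_smul' g x := by
    refine Bispan.CompA.ext ?_ rfl rfl
    change normSumLeft f (f (g • x)) = g • normSumLeft f (f x)
    rw [map_smul, map_smul]

theorem normSumLeft_injective (f : X →[G] Y) : Function.Injective (normSumLeft f) :=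
  fun _ _ h => congrArg Bispan.CompB.d h

/-- Over a constantly left section, a point of `(normSum f).A` is determined by its position in the
fibre of `f`. The norm over these sections is therefore the norm along `f` itself. -/
theorem isPullback_normSumLeft (f : X →[G] Y) :
    IsPullback (normSumLeftPoint f) f (normSum f).n (normSumLeft f) := by
  refine ⟨fun _ => rfl, fun a y h => ?_⟩
  obtain ⟨b, c, a, hm⟩ := a
  obtain rfl : b = normSumLeft f y := h
  obtain ⟨rfl, h2⟩ : f c = y ∧ a = (Sum.inl c : X ⊕ X) := hm
  subst h2
  exact ⟨c, ⟨rfl, rfl⟩, fun e he => congrArg Bispan.CompA.c he.1⟩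

/-- The sum is the transfer of `S.pair a b` along the fold map, so its norm is computed by the
composite bispan `normSum f`. Splitting the final transfer at the constantly left sections isolates
`S.nm f a`. -/
theorem nm_add (f : X →[G] Y) (a b : S.val X) :
    S.nm f (a + b) = S.nm f a +
      S.tr ((normSum f).t.comp (complIncl (normSumLeft f)))
        (S.res (complIncl (normSumLeft f))
          (S.nm (normSum f).n (S.res (normSum f).r (S.pair a b)))) := by
  have h : S.nm f (a + b) = S.map (ofBispan (normSum f)) (S.pair a b) :=
    (S.map_map _ _ _).trans (congrArg (fun φ => S.map φ _)
      (ofBispan_comp (Bispan.compData _ _)))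
  rw [h, map_ofBispan, S.tr_split _ (normSumLeft_injective f)]
  congr 1
  rw [S.res_nm (isPullback_normSumLeft f), res_res]
  -- On the left sections the projection to `Y` is the identity, and the evaluation map to `X ⨿ X`
  -- is the left inclusion.
  exact (S.tr_id _).trans (congrArg (S.nm f) (S.res_inl_pair a b))

/-- A section not in `normSumLeft` takes a value in the right summand. -/
theorem exists_right_of_notMem_range (f : X →[G] Y) (w : (normSum f).B)
    (hw : w ∉ Set.range (normSumLeft f)) :
    ∃ (e : (normSum f).A) (x : X), (normSum f).n e = w ∧ (normSum f).r e = X.inr X x := by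
  by_contra! hcon
  obtain ⟨d, R, hR⟩ := w
  -- A section value lies over `c` under the fold map, so once it is on the left it must be `Sum.inl
  -- c`.
  have hl : ∀ c b, R c b → b = (Sum.inl c : X ⊕ X) := by
    rintro c (b | b) hb
    · exact congrArg Sum.inl (hR.1 _ _ hb).2
    · exact (hcon ⟨⟨d, R, hR⟩, c, (Sum.inr b : X ⊕ X), hb⟩ b rfl rfl).elim
  refine hw ⟨d, Bispan.CompB.ext rfl (funext fun c => funext fun b => propext ⟨?_, fun h => ?_⟩)⟩
  · rintro ⟨h1, rfl⟩
    obtain ⟨b, hb, -⟩ := hR.2 c h1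
    exact hl c b hb ▸ hb
  · exact ⟨(hR.1 _ _ h).1, hl c b h⟩

end SemiTambaraFunctor

/-! ### Closure of ideals under maps of general `G`-sets -/

namespace TambaraIdeal

open FinGSet SemiTambaraFunctor

variable {G : Type u} [Group G] [Finite G] {T : TambaraFunctor.{u, w} G} (I J : TambaraIdeal T)
  {H K : Subgroup G}

/-- The restriction along the inverse of a conjugation is the transfer along the conjugation, which
is the form in which `conj_mem` is stated. -/
theorem res_mem_of_mem (φ : orbit K →[G] orbit H) {x : T.level H} (hx : x ∈ I.level H) :
    T.res φ x ∈ I.level K := by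
  obtain ⟨g, h, rfl⟩ := exists_invHom_comp_orbitMap φ
  rw [← T.res_res, ← T.isCovariant_tr.map_eq_res_invHom]
  exact I.res_mem h (I.conj_mem g hx)

theorem tr_mem_of_mem (φ : orbit H →[G] orbit K) {x : T.level H} (hx : x ∈ I.level H) :
    T.tr φ x ∈ I.level K := by
  obtain ⟨g, h, rfl⟩ := exists_orbitMap_comp_orbitConj φ
  rw [← T.tr_tr]
  exact I.tr_mem h (I.conj_mem g hx)

theorem nm_mem_of_mem (φ : orbit H →[G] orbit K) {x : T.level H} (hx : x ∈ I.level H) :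
    T.nm φ x ∈ I.level K := by
  obtain ⟨g, h, rfl⟩ := exists_orbitMap_comp_orbitConj φ
  rw [← T.nm_nm, T.isCovariant_nm.map_eq_res_invHom _ (orbitConj_bijective g H),
    ← T.isCovariant_tr.map_eq_res_invHom]
  exact I.nm_mem h (I.conj_mem g hx)

/-- A norm along `X → G/K` lies in `I` if the element lies in `I` on one orbit of `X`. -/
theorem nm_mem_of_res_mem {X : FinGSet G} (f : X →[G] orbit K) {x : T.val X} (e : X)
    (hx : T.res (ofStabilizer e) x ∈ I.level (MulAction.stabilizer G e)) :
    T.nm f x ∈ I.level K := by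
  -- The norm is a product over orbits, so one factor in the ideal suffices.
  rw [T.nm_split _ (ofStabilizer_injective e)]
  exact (I.level K).mul_mem_right _ (I.nm_mem_of_mem _ hx)

/-- A transfer along `X → G/K` lies in `I` if the element lies in `I` on all orbits of `X`. -/
theorem tr_mem_of_res_mem {X : FinGSet G} (f : X →[G] orbit K) {x : T.val X}
    (hx : ∀ (L : Subgroup G) (φ : orbit L →[G] X), T.res φ x ∈ I.level L) :
    T.tr f x ∈ I.level K := by
  induction hn : Nat.card X using Nat.strong_induction_on generalizing X with
  | _ n ih =>
    subst hn
    rcases isEmpty_or_nonempty X with hX | ⟨⟨e⟩⟩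
    · rw [T.tr_of_isEmpty]
      exact (I.level K).zero_mem
    -- The orbit of `e` is peeled off; the complement misses `e`, so it has fewer points.
    · rw [T.tr_split _ (ofStabilizer_injective e)]
      refine (I.level K).add_mem (I.tr_mem_of_mem _ (hx _ _)) (ih _ ?_ _ (fun L φ => ?_) rfl)
      · exact Finite.card_subtype_lt (x := e)
          (not_not.2 ⟨basePoint _, one_smul G e⟩)
      · rw [T.res_res]
        exact hx _ _

/-- The correction term is the transfer over the sections that are not constantly left. It is tested
on one orbit of such sections at a time, where a norm with a factor coming from `b` appears. -/
theorem exists_nm_add_eq (φ : orbit H →[G] orbit K) (a : T.level H) {b : T.level H}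
    (hb : b ∈ I.level H) : ∃ c ∈ I.level K, T.nm φ (a + b) = T.nm φ a + c := by
  refine ⟨_, I.tr_mem_of_res_mem _ fun L ψ => ?_, T.nm_add φ a b⟩
  -- By base change, the restriction of the norm to `G/L` is a norm along a map from a pullback to
  -- `G/L`.
  rw [T.res_res, T.res_nm (isPullback_pullback _ _), T.res_res]
  obtain ⟨e, x, he, hx⟩ := exists_right_of_notMem_range φ _ (ψ (basePoint L)).2
  let z : pullback (normSum φ).n ((complIncl (normSumLeft φ)).comp ψ) :=
    ⟨(e, basePoint L), he⟩
  -- The point `z` records where the section at the base point takes a right value; membership on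
  -- the orbit of `z` suffices.
  refine I.nm_mem_of_res_mem _ z ?_
  rw [T.res_res]
  -- On this orbit the evaluation map stays in the right summand, so the pair `(a, b)` restricts to
  -- a restriction of `b`.
  obtain ⟨χ, hχ⟩ := exists_comp_eq_of_injective ((orbit H).inr (orbit H)) Sum.inr_injective
    (((normSum φ).r.comp (pullbackFst _ _)).comp (ofStabilizer z))
    ⟨x, ((congrArg (normSum φ).r (one_smul G e)).trans hx).symm⟩
  rw [← hχ, ← T.res_res, T.res_inr_pair]
  exact I.res_mem_of_mem χ hb

/-! ### Sums of ideals, the zero ideal and unions of chains -/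

/-- The levelwise sum of two Tambara ideals. -/
noncomputable def sup : TambaraIdeal T where
  level H := I.level H ⊔ J.level H
  res_mem h x hx := by
    obtain ⟨a, ha, b, hb, rfl⟩ := Submodule.mem_sup.1 hx
    exact Submodule.mem_sup.2 ⟨_, I.res_mem h ha, _, J.res_mem h hb, (T.res_add _ a b).symm⟩
  tr_mem h x hx := by
    obtain ⟨a, ha, b, hb, rfl⟩ := Submodule.mem_sup.1 hx
    exact Submodule.mem_sup.2 ⟨_, I.tr_mem h ha, _, J.tr_mem h hb, (T.tr_add _ a b).symm⟩
  nm_mem h x hx := by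
    obtain ⟨a, ha, b, hb, rfl⟩ := Submodule.mem_sup.1 hx
    -- The norm of `a` stays in `I`, and the failure of additivity is absorbed by `J`.
    obtain ⟨c, hc, h'⟩ := J.exists_nm_add_eq (orbitMap h) a hb
    exact Submodule.mem_sup.2 ⟨_, I.nm_mem h ha, c, hc, h'.symm⟩
  conj_mem g _ x hx := by
    obtain ⟨a, ha, b, hb, rfl⟩ := Submodule.mem_sup.1 hx
    exact Submodule.mem_sup.2 ⟨_, I.conj_mem g ha, _, J.conj_mem g hb, (T.tr_add _ a b).symm⟩

theorem orbitMap_surjective {H K : Subgroup G} (h : H ≤ K) :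
    Function.Surjective (orbitMap h) := by
  intro x
  obtain ⟨x, rfl⟩ := QuotientGroup.mk_surjective x
  exact ⟨QuotientGroup.mk x, rfl⟩

/-- The zero ideal. -/
noncomputable def zero (T : TambaraFunctor.{u, w} G) : TambaraIdeal T where
  level _ := ⊥
  res_mem h x hx := by
    obtain rfl := (Submodule.mem_bot _).1 hx
    exact (Submodule.mem_bot _).2 (T.res_zero _)
  tr_mem h x hx := by
    obtain rfl := (Submodule.mem_bot _).1 hx
    exact (Submodule.mem_bot _).2 (T.tr_zero _)
  nm_mem h x hx := by
    obtain rfl := (Submodule.mem_bot _).1 hx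
    exact (Submodule.mem_bot _).2 (T.nm_zero _ (orbitMap_surjective h))
  conj_mem g _ x hx := by
    obtain rfl := (Submodule.mem_bot _).1 hx
    exact (Submodule.mem_bot _).2 (T.tr_zero _)

/-- A chain is directed, so the supremum is a plain union and each closure condition can be checked
inside one member of the chain. -/
theorem mem_iSup_level_iff {c : Set (TambaraIdeal T)} (hc : IsChain (· ≤ ·) c) (hne : c.Nonempty)
    {H : Subgroup G} {x : T.level H} :
    x ∈ ⨆ I : c, I.1.level H ↔ ∃ I ∈ c, x ∈ I.level H := by
  have : Nonempty c := hne.to_subtype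
  rw [Submodule.mem_iSup_of_directed]
  · simp only [Subtype.exists, exists_prop]
  · intro I J
    rcases hc.total I.2 J.2 with h | h
    · exact ⟨J, h H, le_rfl⟩
    · exact ⟨I, le_rfl, h H⟩

/-- The levelwise union of a nonempty chain of Tambara ideals. -/
noncomputable def chainSup {c : Set (TambaraIdeal T)} (hc : IsChain (· ≤ ·) c)
    (hne : c.Nonempty) : TambaraIdeal T where
  level H := ⨆ I : c, I.1.level H
  res_mem h x hx := by
    obtain ⟨I, hI, hx⟩ := (mem_iSup_level_iff hc hne).1 hx
    exact (mem_iSup_level_iff hc hne).2 ⟨I, hI, I.res_mem h hx⟩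
  tr_mem h x hx := by
    obtain ⟨I, hI, hx⟩ := (mem_iSup_level_iff hc hne).1 hx
    exact (mem_iSup_level_iff hc hne).2 ⟨I, hI, I.tr_mem h hx⟩
  nm_mem h x hx := by
    obtain ⟨I, hI, hx⟩ := (mem_iSup_level_iff hc hne).1 hx
    exact (mem_iSup_level_iff hc hne).2 ⟨I, hI, I.nm_mem h hx⟩
  conj_mem g _ x hx := by
    obtain ⟨I, hI, hx⟩ := (mem_iSup_level_iff hc hne).1 hx
    exact (mem_iSup_level_iff hc hne).2 ⟨I, hI, I.conj_mem g hx⟩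

theorem mul_mem_mul {x y : T.level H} (hx : x ∈ I.level H) (hy : y ∈ J.level H) :
    x * y ∈ (I * J).level H := by
  change x * y ∈ ⨅ (K : TambaraIdeal T) (_ : ∀ L, I.level L * J.level L ≤ K.level L), K.level H
  simp only [Submodule.mem_iInf]
  exact fun K hK => hK H (Ideal.mul_mem_mul hx hy)

/-! ### Ideals maximal among those disjoint from `S` -/

theorem exists_maximal_disjoint {S : Set (T.level H)} (h0 : (0 : T.level H) ∉ S) :
    ∃ p : TambaraIdeal T,
      Maximal (fun I : TambaraIdeal T => Disjoint (I.level H : Set (T.level H)) S) p := by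
  -- Starting Zorn's lemma at the zero ideal leaves only nonempty chains to bound.
  obtain ⟨p, -, hp⟩ := zorn_le_nonempty₀
    {I : TambaraIdeal T | Disjoint (I.level H : Set (T.level H)) S} (fun c hcS hc I hI => by
      refine ⟨chainSup hc ⟨I, hI⟩, Set.disjoint_left.2 fun x hx => ?_, fun J hJ L x hx =>
        (mem_iSup_level_iff hc ⟨I, hI⟩).2 ⟨J, hJ, hx⟩⟩
      obtain ⟨J, hJ, hx⟩ := (mem_iSup_level_iff hc ⟨I, hI⟩).1 hx
      exact Set.disjoint_left.1 (hcS hJ) hx) (zero T) (by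
      refine Set.disjoint_left.2 fun x hx => ?_
      obtain rfl : x = 0 := (Submodule.mem_bot _).1 hx
      exact h0)
  exact ⟨p, hp⟩

-- If the sum of `p` and `I` were disjoint from `S`, maximality would force it, and with it `I`,
-- into `p`.
variable {I} in
theorem exists_add_mem_of_maximal {S : Set (T.level H)} {p : TambaraIdeal T}
    (hp : Maximal (fun I : TambaraIdeal T => Disjoint (I.level H : Set (T.level H)) S) p)
    (hI : ¬I ≤ p) : ∃ a ∈ p.level H, ∃ b ∈ I.level H, a + b ∈ S := by
  have h : ¬Disjoint ((sup p I).level H : Set (T.level H)) S := fun h =>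
    hI (le_trans (fun _ => le_sup_right) (hp.2 h fun _ => le_sup_left))
  obtain ⟨x, hx, hxS⟩ := Set.not_disjoint_iff.1 h
  obtain ⟨a, ha, b, hb, rfl⟩ := Submodule.mem_sup.1 hx
  exact ⟨a, ha, b, hb, hxS⟩

end TambaraIdeal

theorem mainTheorem7 {G : Type u} [Group G] [Finite G] (T : TambaraFunctor.{u, w} G)
    (H : Subgroup G) (S : Set (T.level H)) (hS : ∀ a ∈ S, ∀ b ∈ S, a * b ∈ S)
    (h0 : (0 : T.level H) ∉ S) :
    (∃ p : TambaraIdeal T,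
      Maximal (fun I : TambaraIdeal T => Disjoint (I.level H : Set (T.level H)) S) p) ∧
    (S.Nonempty → ∀ p : TambaraIdeal T,
      Maximal (fun I : TambaraIdeal T => Disjoint (I.level H : Set (T.level H)) S) p →
        p.IsPrime) := by
  refine ⟨TambaraIdeal.exists_maximal_disjoint h0, fun ⟨s, hs⟩ p hp => ⟨⟨H, fun h => ?_⟩,
    fun I J hIJ => ?_⟩⟩
  · exact Set.disjoint_left.1 hp.1 (by rw [h]; exact Submodule.mem_top) hs
  · by_contra! hcon
    obtain ⟨a, ha, b, hb, hab⟩ := TambaraIdeal.exists_add_mem_of_maximal hp hcon.1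
    obtain ⟨c, hc, d, hd, hcd⟩ := TambaraIdeal.exists_add_mem_of_maximal hp hcon.2
    refine Set.disjoint_left.1 hp.1 ?_ (hS _ hab _ hcd)
    have hbd : b * d ∈ p.level H := hIJ H (TambaraIdeal.mul_mem_mul I J hb hd)
    -- The terms are grouped so that each has a factor `a` or `c` from `p`, except `b * d`.
    have h : (a + b) * (c + d) = (c + d) * a + b * c + b * d := by ring
    rw [h]
    exact (p.level H).add_mem ((p.level H).add_mem ((p.level H).mul_mem_left _ ha)
      ((p.level H).mul_mem_left _ hc)) hbd
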